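/- Let $\mathcal S$ (states) and $\mathcal A$ (actions) be finite sets and let $\mathcal D_1,\dots,\mathcal D_N$ be finite teams of agents; put $|\mathcal D|=\max_i|\mathcal D_i|$. In state $s$, agent $d\in\mathcal D_i$ takes action $a$ with probability $p_d(a\mid s)$, and the environment, which is common to all the teams, moves from $(s,a)$ to $s'$ with probability $p(s'\mid s,a)$. A switching policy of team $i$ is a family of maps $\pi=(\pi_t)_{t=1}^{L}$, $\pi_t:\mathcal S\times\mathcal D_i\to\mathcal D_i$. In an episode of length $L$ started at $(s_1,d_0)$ one has $d_t=\pi_t(s_t,d_{t-1})$, $a_t\sim p_{d_t}(\cdot\mid s_t)$, $s_{t+1}\sim p(\cdot\mid s_t,a_t)$ for $t=1,\dots,L$, and the total cost is $c(\tau\mid s_1,d_0)=\sum_{t=1}^{L}\bigl(c'(s_t,a_t)+c_c(d_t)+c_x(d_t,d_{t-1})\bigr)$, where the known cost functions (which may depend on the team) satisfy $0\le c'(s,a)+c_c(d)+c_x(d,d')\le 1$ for all $s,a,d,d'$. Every team goes through $K$ episodes of length $L$; put $T=KL$. Given the past episodes, the $k$-th episodes of the teams are independent; they start at pairs $(s_1,d_0)$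 that may depend on $k$, on the team and on the past episodes. Let $\delta\in(0,1)$. Just before episode $k$, let $N_k^i(s,d)$ and $N^i_k(s,d,a)$ be the numbers of time steps in the first $k-1$ episodes of team $i$ with $(s_t,d_t)=(s,d)$, and with $(s_t,d_t,a_t)=(s,d,a)$; let $N'_k(s,a)$ and $N'_k(s,a,s')$ be the numbers of time steps in the first $k-1$ episodes of all the teams together with $(s_t,a_t)=(s,a)$, and with $(s_t,a_t,s_{t+1})=(s,a,s')$. Let $\hat p^{\,k}_{d}(a\mid s)=N^i_k(s,d,a)/N_k^i(s,d)$ (or $1/|\mathcal A|$ if $N_k^i(s,d)=0$) and $\hat p^{\,k}(s'\mid s,a)=N'_k(s,a,s')/N'_k(s,a)$ (or $1/|\mathcal S|$ if $N'_k(s,a)=0$). The confidence set $\mathcal P^k_{\mathcal D_i}(\delta)$ of team $i$ consists of all families of probability distributions $p_d(\cdot\mid s,t)$ on $\mathcal A$, for $s\in\mathcal S$, $d\in\mathcal D_i$, $1\le t\le L$, with $$\|p_d(\cdot\mid s,t)-\hat p^{\,k}_d(\cdot\mid s)\|_1\le\sqrt{\frac{2\log\bigl((k-1)^7L^7|\mathcal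 S||\mathcal D_i|2^{|\mathcal A|+1}/\delta\bigr)}{\max\{1,N^i_k(s,d)\}}},$$ and the shared confidence set $\mathcal P^k(\delta)$ consists of all families of probability distributions $p(\cdot\mid s,a,t)$ on $\mathcal S$ with $$\|p(\cdot\mid s,a,t)-\hat p^{\,k}(\cdot\mid s,a)\|_1\le\sqrt{\frac{2\log\bigl((k-1)^7L^7|\mathcal S||\mathcal A|2^{|\mathcal S|+1}/\delta\bigr)}{\max\{1,N'_k(s,a)\}}}.$$ Suppose that the policies are found by $N$ instances of UCRL2-MC with a shared confidence set for the environment: for every team $i$ and every $k\ge 2$, team $i$ uses in episode $k$ a policy $$\pi_i^k\in\operatorname*{arg\,min}_{\pi}\ \min_{P_{\mathcal D}\in\mathcal P^k_{\mathcal D_i}(\delta)}\ \min_{P\in\mathcal P^k(\delta)}\ \mathbb E_{\tau\sim\pi,P_{\mathcal D},P}\bigl[c(\tau\mid s_1,d_0)\bigr]$$ (with $(s_1,d_0)$ the start of that episode and ties broken in any way, possibly depending on the past), and the policies $\pi_i^1$ of the first episode, where there are no data, are arbitrary. The total regret is $$R(T,N)=\sum_{i=1}^{N}\sum_{k=1}^{K}\Bigl(\mathbb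 E_{\tau\sim\pi_i^k}\bigl[c(\tau\mid s_1,d_0)\bigr]-\min_{\pi}\mathbb E_{\tau\sim\pi}\bigl[c(\tau\mid s_1,d_0)\bigr]\Bigr),$$ where the expectations are taken under the true agents' policies and transition probabilities. Then there are absolute constants $\rho_1,\rho_2>0$ such that in every such setting, with probability at least $1-\delta$, $$R(T,N)\le\rho_1NL\sqrt{|\mathcal A||\mathcal S||\mathcal D|\,T\log\Bigl(\frac{|\mathcal S||\mathcal D|T}{\delta}\Bigr)}+\rho_2L|\mathcal S|\sqrt{|\mathcal A|NT\log\Bigl(\frac{|\mathcal S||\mathcal A|T}{\delta}\Bigr)}.$$ -/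

import Mathlib

namespace Switching

section Episode

variable {S A D : Type*} {L : ℕ}

/-- The immediate costs of a team: `env s a` is the environment cost `c'(s, a)`, `control d` is the
cost `c_c(d)` of giving control to agent `d`, and `switch d d'` is the cost `c_x(d, d')` of
switching from `d'` to `d`. -/
structure Costs (S A D : Type*) where
  env : S → A → ℝ
  control : D → ℝ
  switch : D → D → ℝ

/-- The cost `c'(s, a) + c_c(d) + c_x(d, d')` of one time step. -/
def Costs.step (C : Costs S A D) (s : S) (a : A) (d d' : D) : ℝ :=
  C.env s a + C.control d + C.switch d d'

/-- Deterministic time-varying switching policies `d_t = π_t(s_t, d_{t-1})`. -/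
abbrev Policy (S D : Type*) (L : ℕ) := Fin L → S → D → D

/-- The record of an episode: states `s_1, …, s_{L+1}`, switch values `d_0, …, d_L`, and
actions `a_1, …, a_L`. -/
abbrev Traj (S A D : Type*) (L : ℕ) := (Fin (L + 1) → S) × (Fin (L + 1) → D) × (Fin L → A)

/-- The state `s_t`. -/
abbrev Traj.state (τ : Traj S A D L) (t : Fin L) : S := τ.1 t.castSucc

/-- The state `s_{t+1}`. -/
abbrev Traj.next (τ : Traj S A D L) (t : Fin L) : S := τ.1 t.succ

/-- The switch value `d_{t-1}`. -/
abbrev Traj.prev (τ : Traj S A D L) (t : Fin L) : D := τ.2.1 t.castSucc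

/-- The switch value `d_t`. -/
abbrev Traj.switch (τ : Traj S A D L) (t : Fin L) : D := τ.2.1 t.succ

/-- The action `a_t`. -/
abbrev Traj.action (τ : Traj S A D L) (t : Fin L) : A := τ.2.2 t

/-- The total cost of a trajectory. -/
def Traj.cost (C : Costs S A D) (τ : Traj S A D L) : ℝ :=
  ∑ t, C.step (Traj.state τ t) (Traj.action τ t) (Traj.switch τ t) (Traj.prev τ t)

variable [DecidableEq S] [DecidableEq D]

/-- The probability of the trajectory `τ` when an episode starts at `x = (s_1, d_0)` and the
policy `π` is deployed, where at time `t` agent `d` takes action `a` in state `s` with probability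
`PD t s d a` and the environment moves from `(s, a)` to `s'` with probability `P t s a s'`. -/
def trajProb (PD : Fin L → S → D → A → ℝ) (P : Fin L → S → A → S → ℝ) (π : Policy S D L)
    (x : S × D) (τ : Traj S A D L) : ℝ :=
  (if τ.1 0 = x.1 ∧ τ.2.1 0 = x.2 then 1 else 0) *
    ∏ t, ((if Traj.switch τ t = π t (Traj.state τ t) (Traj.prev τ t) then 1 else 0) *
      PD t (Traj.state τ t) (Traj.switch τ t) (Traj.action τ t) *
      P t (Traj.state τ t) (Traj.action τ t) (Traj.next τ t))

/-- The expected total cost `𝔼_{τ ∼ π, PD, P} [c(τ | s_1, d_0)]`. -/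
def expectedCost [Fintype S] [Fintype A] [Fintype D] (C : Costs S A D)
    (PD : Fin L → S → D → A → ℝ) (P : Fin L → S → A → S → ℝ) (π : Policy S D L)
    (x : S × D) : ℝ :=
  ∑ τ : Traj S A D L, trajProb PD P π x τ * Traj.cost C τ

end Episode

/-- The data of the first `k` episodes of all the teams. -/
abbrev History (S A : Type*) {N : ℕ} (D : Fin N → Type*) (L k : ℕ) :=
  Fin k → (i : Fin N) → Traj S A (D i) L

section Teams

variable {S A : Type*} {N : ℕ} {D : Fin N → Type*} {L : ℕ}

/-- The size `|𝒟|` of the (largest) team. -/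
def teamSize (D : Fin N → Type*) [∀ i, Fintype (D i)] : ℕ :=
  Finset.univ.sup fun i => Fintype.card (D i)

/-- What has been observed before the episode number `k` (numbered from `0`) of a run starts. -/
def History.past {K : ℕ} (h : History S A D L K) (k : Fin K) : History S A D L k :=
  fun j => h (Fin.castLE k.is_lt.le j)

variable [Fintype S] [Fintype A] [∀ i, Fintype (D i)]
variable [DecidableEq S] [DecidableEq A] [∀ i, DecidableEq (D i)]

/-! Counts. Those for the agents use the data of team `i` alone, those for the environment pool the
data of all the teams. -/

/-- How often agent `d` of team `i` was in control in state `s`. -/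
def agentCount {k : ℕ} (h : History S A D L k) (i : Fin N) (s : S) (d : D i) : ℕ :=
  ∑ l, ∑ t, if Traj.state (h l i) t = s ∧ Traj.switch (h l i) t = d then 1 else 0

/-- How often agent `d` of team `i` was in control in state `s` and took action `a`. -/
def agentActionCount {k : ℕ} (h : History S A D L k) (i : Fin N) (s : S) (d : D i) (a : A) : ℕ :=
  ∑ l, ∑ t, if Traj.state (h l i) t = s ∧ Traj.switch (h l i) t = d ∧
    Traj.action (h l i) t = a then 1 else 0

/-- How often action `a` was taken in state `s`, over all the teams. -/
def envCount {k : ℕ} (h : History S A D L k) (s : S) (a : A) : ℕ :=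
  ∑ l, ∑ i, ∑ t, if Traj.state (h l i) t = s ∧ Traj.action (h l i) t = a then 1 else 0

/-- How often action `a` was taken in state `s` and led to state `s'`, over all the teams. -/
def envNextCount {k : ℕ} (h : History S A D L k) (s : S) (a : A) (s' : S) : ℕ :=
  ∑ l, ∑ i, ∑ t, if Traj.state (h l i) t = s ∧ Traj.action (h l i) t = a ∧
    Traj.next (h l i) t = s' then 1 else 0

/-- The empirical policy of agent `d` of team `i`. -/
noncomputable def agentEmp {k : ℕ} (h : History S A D L k) (i : Fin N) (s : S) (d : D i)
    (a : A) : ℝ :=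
  if agentCount h i s d = 0 then 1 / (Fintype.card A : ℝ)
  else (agentActionCount h i s d a : ℝ) / (agentCount h i s d : ℝ)

/-- The empirical transition probability of the environment. -/
noncomputable def envEmp {k : ℕ} (h : History S A D L k) (s : S) (a : A) (s' : S) : ℝ :=
  if envCount h s a = 0 then 1 / (Fintype.card S : ℝ)
  else (envNextCount h s a s' : ℝ) / (envCount h s a : ℝ)

/-- The confidence radius for the policy of agent `d` of team `i` after `k` episodes (that is,
just before the episode which has number `k + 1` when one counts from `1`). -/
noncomputable def agentRadius (δ : ℝ) {k : ℕ} (h : History S A D L k) (i : Fin N) (s : S)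
    (d : D i) : ℝ :=
  Real.sqrt (2 * Real.log ((k : ℝ) ^ 7 * (L : ℝ) ^ 7 * Fintype.card S * Fintype.card (D i) *
    2 ^ (Fintype.card A + 1) / δ) / max 1 (agentCount h i s d : ℝ))

/-- The confidence radius for the environment after `k` episodes. -/
noncomputable def envRadius (δ : ℝ) {k : ℕ} (h : History S A D L k) (s : S) (a : A) : ℝ :=
  Real.sqrt (2 * Real.log ((k : ℝ) ^ 7 * (L : ℝ) ^ 7 * Fintype.card S * Fintype.card A *
    2 ^ (Fintype.card S + 1) / δ) / max 1 (envCount h s a : ℝ))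

/-- The rectangular `L¹` confidence set for the (time-varying) agents' policies of team `i`. -/
def agentConf (δ : ℝ) {k : ℕ} (h : History S A D L k) (i : Fin N) :
    Set (Fin L → S → D i → A → ℝ) :=
  {PD | ∀ t s d, PD t s d ∈ stdSimplex ℝ A ∧
    ∑ a, |PD t s d a - agentEmp h i s d a| ≤ agentRadius δ h i s d}

/-- The rectangular `L¹` confidence set for the (time-varying) transition probabilities of the
environment, shared by all the teams. -/
def envConf (δ : ℝ) {k : ℕ} (h : History S A D L k) : Set (Fin L → S → A → S → ℝ) :=
  {P | ∀ t s a, P t s a ∈ stdSimplex ℝ S ∧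
    ∑ s', |P t s a s' - envEmp h s a s'| ≤ envRadius δ h s a}

/-- `π` is a minimizer over the switching policies of
`min_{PD ∈ agentConf} min_{P ∈ envConf} 𝔼_{τ ∼ π, PD, P} [c(τ | s_1, d_0)]`, where
`x = (s_1, d_0)`: together with some members of the two confidence sets, `π` attains the smallest
expected cost that is possible with any policy and any members of the confidence sets. -/
def IsOptimistic (C : (i : Fin N) → Costs S A (D i)) (δ : ℝ) {k : ℕ} (h : History S A D L k)
    (i : Fin N) (x : S × D i) (π : Policy S (D i) L) : Prop :=
  ∃ PD ∈ agentConf δ h i, ∃ P ∈ envConf δ h,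
    ∀ π' : Policy S (D i) L, ∀ PD' ∈ agentConf δ h i, ∀ P' ∈ envConf δ h,
      expectedCost (C i) PD P π x ≤ expectedCost (C i) PD' P' π' x

/-- `π k h i` is the switching policy that team `i` uses in episode number `k` (numbered from `0`)
after the past `h`, and `init k h i` is the pair `(s_1, d_0)` at which that episode starts. The
policies are those of `N` instances of UCRL2-MC with a shared confidence set for the environment:
in every episode they are optimistic, with ties broken in any way. In the very first episode, where
the confidence radii would contain the logarithm of zero, the policies are arbitrary. -/
def IsSharedUCRL2MC (C : (i : Fin N) → Costs S A (D i)) (δ : ℝ)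
    (init : (k : ℕ) → History S A D L k → (i : Fin N) → S × D i)
    (π : (k : ℕ) → History S A D L k → (i : Fin N) → Policy S (D i) L) : Prop :=
  ∀ k : ℕ, 1 ≤ k → ∀ (h : History S A D L k) (i : Fin N),
    IsOptimistic C δ h i (init k h i) (π k h i)

/-- The probability of the run `h` of `K` episodes for each team, under the true agents' policies
`pD i` and the true transition probabilities `p`. Given the past, the episodes that the teams go
through at the same time are independent. -/
def runProb (pD : (i : Fin N) → S → D i → A → ℝ) (p : S → A → S → ℝ)
    (init : (k : ℕ) → History S A D L k → (i : Fin N) → S × D i)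
    (π : (k : ℕ) → History S A D L k → (i : Fin N) → Policy S (D i) L)
    {K : ℕ} (h : History S A D L K) : ℝ :=
  ∏ k : Fin K, ∏ i, trajProb (fun _ => pD i) (fun _ => p) (π k (h.past k) i) (init k (h.past k) i) (h k i)

open Classical in
/-- The probability of an event about the runs of `K` episodes for each team. -/
noncomputable def probability (pD : (i : Fin N) → S → D i → A → ℝ) (p : S → A → S → ℝ)
    (init : (k : ℕ) → History S A D L k → (i : Fin N) → S × D i)
    (π : (k : ℕ) → History S A D L k → (i : Fin N) → Policy S (D i) L)
    {K : ℕ} (E : Set (History S A D L K)) : ℝ :=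
  ∑ h : History S A D L K, if h ∈ E then runProb pD p init π h else 0

/-- The total regret of a run. There are finitely many switching policies, so the infimum is the
expected cost of an optimal switching policy. -/
noncomputable def regret (C : (i : Fin N) → Costs S A (D i))
    (pD : (i : Fin N) → S → D i → A → ℝ) (p : S → A → S → ℝ)
    (init : (k : ℕ) → History S A D L k → (i : Fin N) → S × D i)
    (π : (k : ℕ) → History S A D L k → (i : Fin N) → Policy S (D i) L)
    {K : ℕ} (h : History S A D L K) : ℝ :=
  ∑ i, ∑ k : Fin K, (expectedCost (C i) (fun _ => pD i) (fun _ => p)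
      (π k (h.past k) i) (init k (h.past k) i) -
    ⨅ π' : Policy S (D i) L, expectedCost (C i) (fun _ => pD i) (fun _ => p)
      π' (init k (h.past k) i))

end Teams

end Switching

/-! Write a, s, d for the numbers of actions, states and agents of the largest team, T = KL, and let
B be the first square root of the bound, so that its first term is a multiple of NLB. A team loses
at most L per episode. If d ≤ 1 there is only one policy and no regret; if K ≤ 8B the trivial bound
NKL suffices. So let K > 8B and d ≥ 2. Then B is at least 8L times a·s·d·log(sdT/δ) (`budget_le`),
and every term without a root of T disappears in NLB.

The main line is optimism. If the true model is in the confidence sets, an optimistic policy loses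
no more than the difference between its costs under the true and under the optimistic model. By the
simulation lemma `abs_trajExp_sub_le` this is at most L times the expected sum, under the true law,
of the widths of the sets along the episode. An exponential supermartingale (`runExp_exp_le_one`)
replaces expected widths by twice the observed ones plus O(NL log(1/δ)). A pigeonhole argument
(`sum_mul_min_le`) and Cauchy-Schwarz bound the observed widths; pooling the environment data puts N
under the root in the second term.

The difficulty is that the radii do not contain N, so the true model need not lie in all confidence
sets with probability 1 - δ. There are two remedies.

For the agents, a set built on k episodes fails with probability at most δ/k². A union bound over
teams is too expensive, but the expected number of failing pairs of a team and an episode is at most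
2Nδ. By Markov's inequality it exceeds 8N with probability at most δ/4, and 8N failures cost only
8NL.

For the environment, the pooled count can be as large as kNL, so a union bound over its values would
cost a factor N. Instead the true transition probabilities may deviate from the empirical ones by ε
= B/T even where the radius is smaller (`EnvGood`); this costs 2L²ε per team and episode, 2NLB in
all. Counts above n₀ = ⌊B⁴⌋ then have a geometric tail at deviation ε, whose sum is free of N and
tiny (`exp_tail_le`). Counts up to n₀ cost n₀δ/(2k⁷), which is summable and small once k ≥ B, since
then n₀ ≤ k⁴. The first ⌈B⌉ episodes are paid for at the trivial rate, NL⌈B⌉ in all.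

The bad events have total probability at most 3δ/4, and `total_le` adds up the costs. -/

namespace Switching

set_option linter.unusedSectionVars false

/-! ### Expectations over one episode, and the simulation lemma -/

section TrajExp

variable {S A D : Type*} {L : ℕ}

/-- The episode that starts at `y`, takes action `a`, and then goes on as `τ`. -/
def Traj.cons (y : S × D) (a : A) (τ : Traj S A D L) : Traj S A D (L + 1) :=
  (Fin.cons y.1 τ.1, Fin.cons y.2 τ.2.1, Fin.cons a τ.2.2)

/-- An episode of positive length amounts to its start, its first action and its remainder. -/
def Traj.consEquiv : ((S × D) × A × Traj S A D L) ≃ Traj S A D (L + 1) where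
  toFun z := Traj.cons z.1 z.2.1 z.2.2
  invFun τ := ((τ.1 0, τ.2.1 0), τ.2.2 0, Fin.tail τ.1, Fin.tail τ.2.1, Fin.tail τ.2.2)
  left_inv z := by simp [Traj.cons]
  right_inv τ := by simp [Traj.cons]

lemma sum_traj_succ [Fintype S] [Fintype A] [Fintype D] [DecidableEq S] [DecidableEq D]
    (F : Traj S A D (L + 1) → ℝ) :
    ∑ τ, F τ = ∑ y : S × D, ∑ a, ∑ τ : Traj S A D L, F (Traj.cons y a τ) := by
  rw [← Traj.consEquiv.sum_comp F, Fintype.sum_prod_type]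
  refine Finset.sum_congr rfl fun y _ => ?_
  rw [Fintype.sum_prod_type]
  rfl

section cons

variable (y : S × D) (a : A) (τ : Traj S A D L)

@[simp] lemma Traj.cons_state_zero : Traj.state (Traj.cons y a τ) 0 = y.1 := rfl
@[simp] lemma Traj.cons_action_zero : Traj.action (Traj.cons y a τ) 0 = a := rfl
@[simp] lemma Traj.cons_switch_zero : Traj.switch (Traj.cons y a τ) 0 = τ.2.1 0 := rfl
@[simp] lemma Traj.cons_next_zero : Traj.next (Traj.cons y a τ) 0 = τ.1 0 := rfl
@[simp] lemma Traj.cons_state_succ (t : Fin L) :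
    Traj.state (Traj.cons y a τ) t.succ = Traj.state τ t := rfl
@[simp] lemma Traj.cons_action_succ (t : Fin L) :
    Traj.action (Traj.cons y a τ) t.succ = Traj.action τ t := rfl
@[simp] lemma Traj.cons_switch_succ (t : Fin L) :
    Traj.switch (Traj.cons y a τ) t.succ = Traj.switch τ t := rfl
@[simp] lemma Traj.cons_next_succ (t : Fin L) :
    Traj.next (Traj.cons y a τ) t.succ = Traj.next τ t := rfl

end cons

variable [DecidableEq S] [DecidableEq D]

lemma trajProb_cons (PD : Fin (L + 1) → S → D → A → ℝ) (P : Fin (L + 1) → S → A → S → ℝ)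
    (π : Policy S D (L + 1)) (x y : S × D) (a : A) (τ : Traj S A D L) :
    trajProb PD P π x (Traj.cons y a τ) =
      (if y = x then 1 else 0) * (if τ.2.1 0 = π 0 y.1 y.2 then 1 else 0) *
        (PD 0 y.1 (τ.2.1 0) a * P 0 y.1 a (τ.1 0)) *
        trajProb (fun t => PD t.succ) (fun t => P t.succ) (fun t => π t.succ)
          (τ.1 0, τ.2.1 0) τ := by
  unfold trajProb
  rw [Fin.prod_univ_succ]
  have hyx : (if y = x then (1 : ℝ) else 0) = if y.1 = x.1 ∧ y.2 = x.2 then 1 else 0 :=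
    if_congr Prod.ext_iff rfl rfl
  rw [hyx]
  change (if y.1 = x.1 ∧ y.2 = x.2 then (1 : ℝ) else 0) *
    ((if τ.2.1 0 = π 0 y.1 y.2 then 1 else 0) * PD 0 y.1 (τ.2.1 0) a * P 0 y.1 a (τ.1 0) *
    ∏ t : Fin L, ((if Traj.switch τ t = π t.succ (Traj.state τ t) (Traj.prev τ t) then 1 else 0) *
      PD t.succ (Traj.state τ t) (Traj.switch τ t) (Traj.action τ t) *
      P t.succ (Traj.state τ t) (Traj.action τ t) (Traj.next τ t))) = _
  simp only [and_self, if_true]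
  ring

lemma trajProb_nonneg {PD : Fin L → S → D → A → ℝ} {P : Fin L → S → A → S → ℝ}
    (hPD : ∀ t s d a, 0 ≤ PD t s d a) (hP : ∀ t s a s', 0 ≤ P t s a s') (π : Policy S D L)
    (x : S × D) (τ : Traj S A D L) : 0 ≤ trajProb PD P π x τ := by
  unfold trajProb
  refine mul_nonneg (by split_ifs <;> norm_num) (Finset.prod_nonneg fun t _ => ?_)
  exact mul_nonneg (mul_nonneg (by split_ifs <;> norm_num) (hPD _ _ _ _)) (hP _ _ _ _)

lemma trajProb_eq_zero {PD : Fin L → S → D → A → ℝ} {P : Fin L → S → A → S → ℝ}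
    {π : Policy S D L} {x : S × D} {τ : Traj S A D L} (h : ¬ (τ.1 0 = x.1 ∧ τ.2.1 0 = x.2)) :
    trajProb PD P π x τ = 0 := by
  simp [trajProb, h]

variable [Fintype S] [Fintype A] [Fintype D]

/-- The expectation of `F` over the episodes which start at `x`. -/
def trajExp (PD : Fin L → S → D → A → ℝ) (P : Fin L → S → A → S → ℝ) (π : Policy S D L)
    (x : S × D) (F : Traj S A D L → ℝ) : ℝ :=
  ∑ τ, trajProb PD P π x τ * F τ

lemma expectedCost_eq_trajExp (C : Costs S A D) (PD : Fin L → S → D → A → ℝ)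
    (P : Fin L → S → A → S → ℝ) (π : Policy S D L) (x : S × D) :
    expectedCost C PD P π x = trajExp PD P π x (Traj.cost C) := rfl

/-- Conditioning on the first step of an episode. -/
lemma trajExp_succ (PD : Fin (L + 1) → S → D → A → ℝ) (P : Fin (L + 1) → S → A → S → ℝ)
    (π : Policy S D (L + 1)) (x : S × D) (F : Traj S A D (L + 1) → ℝ) :
    trajExp PD P π x F = ∑ a, ∑ s', PD 0 x.1 (π 0 x.1 x.2) a * P 0 x.1 a s' *
      trajExp (fun t => PD t.succ) (fun t => P t.succ) (fun t => π t.succ) (s', π 0 x.1 x.2)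
        (fun τ => F (Traj.cons x a τ)) := by
  unfold trajExp
  rw [sum_traj_succ, Finset.sum_eq_single x]
  · refine Finset.sum_congr rfl fun a _ => ?_
    simp_rw [Finset.mul_sum]
    rw [Finset.sum_comm]
    refine Finset.sum_congr rfl fun τ _ => ?_
    rw [Finset.sum_eq_single (τ.1 0)]
    -- The law started at `(s', d)` charges only episodes whose first state is `s'`, so the sum over
    -- `s'` has a single nonzero term. If the first agent of `τ` is not the one chosen by the
    -- policy, both sides vanish.
    · rw [trajProb_cons]
      by_cases h : τ.2.1 0 = π 0 x.1 x.2
      · simp only [h, if_true]; ring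
      · rw [trajProb_eq_zero (x := (τ.1 0, π 0 x.1 x.2)) (by simp [h])]
        simp [h]
    · intro s' _ hs'
      rw [trajProb_eq_zero (by simp [hs'.symm])]
      ring
    · simp
  · intro y _ hy
    refine Finset.sum_eq_zero fun a _ => Finset.sum_eq_zero fun τ _ => ?_
    rw [trajProb_cons, if_neg hy]
    ring
  · simp

lemma trajExp_zero (PD : Fin 0 → S → D → A → ℝ) (P : Fin 0 → S → A → S → ℝ)
    (π : Policy S D 0) (x : S × D) (F : Traj S A D 0 → ℝ) :
    trajExp PD P π x F = F (fun _ => x.1, fun _ => x.2, Fin.elim0) := by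
  unfold trajExp
  rw [Finset.sum_eq_single (fun _ => x.1, fun _ => x.2, Fin.elim0)]
  · simp [trajProb]
  · rintro ⟨τ₁, τ₂, τ₃⟩ _ hτ
    rw [trajProb_eq_zero, zero_mul]
    rintro ⟨h₁, h₂⟩
    apply hτ
    ext i
    · obtain rfl : i = 0 := Fin.fin_one_eq_zero i; exact h₁
    · obtain rfl : i = 0 := Fin.fin_one_eq_zero i; exact h₂
    · exact i.elim0
  · simp

lemma trajExp_add (PD : Fin L → S → D → A → ℝ) (P : Fin L → S → A → S → ℝ) (π : Policy S D L)
    (x : S × D) (F G : Traj S A D L → ℝ) :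
    trajExp PD P π x (fun τ => F τ + G τ) = trajExp PD P π x F + trajExp PD P π x G := by
  simp [trajExp, mul_add, Finset.sum_add_distrib]

lemma trajExp_mono {PD : Fin L → S → D → A → ℝ} {P : Fin L → S → A → S → ℝ}
    (hPD : ∀ t s d a, 0 ≤ PD t s d a) (hP : ∀ t s a s', 0 ≤ P t s a s') (π : Policy S D L)
    (x : S × D) {F G : Traj S A D L → ℝ} (h : ∀ τ, F τ ≤ G τ) :
    trajExp PD P π x F ≤ trajExp PD P π x G :=
  Finset.sum_le_sum fun τ _ => mul_le_mul_of_nonneg_left (h τ) (trajProb_nonneg hPD hP π x τ)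

omit [DecidableEq S] [DecidableEq D] [Fintype D] in
lemma sum_sum_mul_of_sum_eq_one {q : A → ℝ} {r : A → S → ℝ} (hq : ∑ a, q a = 1)
    (hr : ∀ a, ∑ s, r a s = 1) : ∑ a, ∑ s, q a * r a s = 1 := by
  simp_rw [← Finset.mul_sum, hr, mul_one, hq]

lemma trajExp_const {PD : Fin L → S → D → A → ℝ} {P : Fin L → S → A → S → ℝ}
    (hPD : ∀ t s d, ∑ a, PD t s d a = 1) (hP : ∀ t s a, ∑ s', P t s a s' = 1)
    (π : Policy S D L) (x : S × D) (c : ℝ) : trajExp PD P π x (fun _ => c) = c := by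
  induction L generalizing x with
  | zero => exact trajExp_zero PD P π x _
  | succ L ih =>
    rw [trajExp_succ]
    simp_rw [ih (fun t => hPD t.succ) (fun t => hP t.succ), ← Finset.sum_mul]
    rw [sum_sum_mul_of_sum_eq_one (hPD 0 _ _) (hP 0 _), one_mul]

/-- A product of nonnegative factors, one for each time step, has expectation at most `1` if each
factor has conditional expectation at most `1`. -/
lemma trajExp_prod_le_one {pD : S → D → A → ℝ} {p : S → A → S → ℝ}
    (hpD : ∀ s d a, 0 ≤ pD s d a) (hp : ∀ s a s', 0 ≤ p s a s')
    {ψ : S → D → A → S → ℝ} (hψ : ∀ s d a s', 0 ≤ ψ s d a s')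
    (h : ∀ s d, ∑ a, ∑ s', pD s d a * p s a s' * ψ s d a s' ≤ 1) (π : Policy S D L) (x : S × D) :
    trajExp (fun _ => pD) (fun _ => p) π x (fun τ => ∏ t, ψ (Traj.state τ t) (Traj.switch τ t)
      (Traj.action τ t) (Traj.next τ t)) ≤ 1 := by
  induction L generalizing x with
  | zero => simp [trajExp_zero]
  | succ L ih =>
    rw [trajExp_succ]
    refine le_trans (Finset.sum_le_sum fun a _ => Finset.sum_le_sum fun s' _ => ?_)
      (h x.1 (π 0 x.1 x.2))
    refine mul_le_mul_of_nonneg_left ?_ (mul_nonneg (hpD _ _ _) (hp _ _ _))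
    -- The factor of the first step depends on `τ` through its start, but it is constant wherever
    -- the law started at `(s', d)` is positive.
    have key : ∀ τ : Traj S A D L, trajProb (fun _ => pD) (fun _ => p) (fun t => π t.succ)
        (s', π 0 x.1 x.2) τ * ∏ t, ψ (Traj.state (Traj.cons x a τ) t)
          (Traj.switch (Traj.cons x a τ) t) (Traj.action (Traj.cons x a τ) t)
          (Traj.next (Traj.cons x a τ) t) =
        ψ x.1 (π 0 x.1 x.2) a s' * (trajProb (fun _ => pD) (fun _ => p) (fun t => π t.succ)
        (s', π 0 x.1 x.2) τ * ∏ t, ψ (Traj.state τ t)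
          (Traj.switch τ t) (Traj.action τ t) (Traj.next τ t)) := by
      intro τ
      by_cases h0 : τ.1 0 = s' ∧ τ.2.1 0 = π 0 x.1 x.2
      · rw [Fin.prod_univ_succ]
        simp only [Traj.cons_state_zero, Traj.cons_action_zero,
          Traj.cons_switch_zero, Traj.cons_next_zero, Traj.cons_state_succ, Traj.cons_action_succ,
          Traj.cons_switch_succ, Traj.cons_next_succ, h0.1, h0.2]
        ring
      · rw [trajProb_eq_zero h0]; ring
    rw [trajExp, Finset.sum_congr rfl fun τ _ => key τ, ← Finset.mul_sum]
    exact mul_le_of_le_one_right (hψ _ _ _ _) (ih (fun t => π t.succ) (s', π 0 x.1 x.2))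

lemma abs_trajExp_le {PD : Fin L → S → D → A → ℝ} {P : Fin L → S → A → S → ℝ}
    (hPD : ∀ t s d, PD t s d ∈ stdSimplex ℝ A) (hP : ∀ t s a, P t s a ∈ stdSimplex ℝ S)
    (π : Policy S D L) (x : S × D) {c : ℝ} {F : Traj S A D L → ℝ} (hF : ∀ τ, |F τ| ≤ c) :
    |trajExp PD P π x F| ≤ c := by
  have h := fun c => trajExp_const (fun t s d => (hPD t s d).2) (fun t s a => (hP t s a).2) π x c
  have m := fun (F G) => trajExp_mono (F := F) (G := G)
    (fun t s d a => (hPD t s d).1 a) (fun t s a => (hP t s a).1) π x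
  rw [abs_le]
  constructor
  · rw [← h (-c)]; exact m _ _ fun τ => (abs_le.1 (hF τ)).1
  · rw [← h c]; exact m _ _ fun τ => (abs_le.1 (hF τ)).2

/-- The simulation lemma: expectations under two models differ by at most the expected sum of the
distances of the models along an episode. -/
lemma abs_trajExp_sub_le {PD PD' : Fin L → S → D → A → ℝ} {P P' : Fin L → S → A → S → ℝ}
    (hPD : ∀ t s d, PD t s d ∈ stdSimplex ℝ A) (hP : ∀ t s a, P t s a ∈ stdSimplex ℝ S)
    (hPD' : ∀ t s d, PD' t s d ∈ stdSimplex ℝ A) (hP' : ∀ t s a, P' t s a ∈ stdSimplex ℝ S)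
    (π : Policy S D L) (x : S × D) {c : ℝ} {F : Traj S A D L → ℝ}
    (hF : ∀ τ, |F τ| ≤ c) :
    |trajExp PD P π x F - trajExp PD' P' π x F| ≤ c * trajExp PD P π x (fun τ => ∑ t,
      (∑ a, |PD t (Traj.state τ t) (Traj.switch τ t) a -
          PD' t (Traj.state τ t) (Traj.switch τ t) a| +
        ∑ s', |P t (Traj.state τ t) (Traj.action τ t) s' -
          P' t (Traj.state τ t) (Traj.action τ t) s'|)) := by
  induction L generalizing x with
  | zero => simp [trajExp_zero]
  | succ L ih =>
    set d := π 0 x.1 x.2 with hd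
    set G : Traj S A D L → ℝ := fun τ => ∑ t : Fin L,
      (∑ a, |PD t.succ (Traj.state τ t) (Traj.switch τ t) a -
          PD' t.succ (Traj.state τ t) (Traj.switch τ t) a| +
        ∑ s', |P t.succ (Traj.state τ t) (Traj.action τ t) s' -
          P' t.succ (Traj.state τ t) (Traj.action τ t) s'|) with hG
    set q := PD 0 x.1 d with hq
    set q' := PD' 0 x.1 d with hq'
    set r := P 0 x.1 with hr
    set r' := P' 0 x.1 with hr'
    have q1 : ∑ a, q a = 1 := (hPD 0 x.1 d).2
    have r1 : ∀ a, ∑ s', r a s' = 1 := fun a => (hP 0 x.1 a).2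
    have r1' : ∀ a, ∑ s', r' a s' = 1 := fun a => (hP' 0 x.1 a).2
    have q0 : ∀ a, 0 ≤ q a := (hPD 0 x.1 d).1
    have r0 : ∀ a s', 0 ≤ r a s' := fun a => (hP 0 x.1 a).1
    have r0' : ∀ a s', 0 ≤ r' a s' := fun a => (hP' 0 x.1 a).1
    let E : S → (Traj S A D L → ℝ) → ℝ := fun s' => trajExp (fun t => PD t.succ)
      (fun t => P t.succ) (fun t => π t.succ) (s', d)
    let E' : S → (Traj S A D L → ℝ) → ℝ := fun s' => trajExp (fun t => PD' t.succ)
      (fun t => P' t.succ) (fun t => π t.succ) (s', d)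
    have hR : trajExp PD P π x (fun τ => ∑ t,
        (∑ a, |PD t (Traj.state τ t) (Traj.switch τ t) a -
            PD' t (Traj.state τ t) (Traj.switch τ t) a| +
          ∑ s', |P t (Traj.state τ t) (Traj.action τ t) s' -
            P' t (Traj.state τ t) (Traj.action τ t) s'|)) =
        ∑ a, ∑ s', q a * r a s' * (E s' G + (∑ a, |q a - q' a| + ∑ s', |r a s' - r' a s'|)) := by
      rw [trajExp_succ]
      refine Finset.sum_congr rfl fun a _ => Finset.sum_congr rfl fun s' _ => ?_
      congr 1
      -- The distance at the first step is rewritten as an expectation, so that both sides can be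
      -- compared episode by episode.
      conv_rhs => rw [← trajExp_const (fun t s d => (hPD (Fin.succ t) s d).2)
        (fun t s a => (hP (Fin.succ t) s a).2) (fun t => π t.succ) (s', d)
        (∑ a, |q a - q' a| + ∑ s', |r a s' - r' a s'|)]
      rw [← trajExp_add]
      refine Finset.sum_congr rfl fun τ _ => ?_
      by_cases h0 : τ.1 0 = s' ∧ τ.2.1 0 = d
      · congr 1
        beta_reduce
        rw [Fin.sum_univ_succ]
        simp only [Traj.cons_state_zero, Traj.cons_action_zero,
          Traj.cons_switch_zero, Traj.cons_state_succ, Traj.cons_action_succ,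
          Traj.cons_switch_succ, h0.2]
        rw [add_comm]
      · rw [trajProb_eq_zero h0]; ring
    rw [hR, trajExp_succ, trajExp_succ]
    have hstep : ∀ a s', q a * r a s' * E s' (fun τ => F (Traj.cons x a τ)) -
        q' a * r' a s' * E' s' (fun τ => F (Traj.cons x a τ)) ≤
        q a * r a s' * (c * E s' G) + (q a * |r a s' - r' a s'| + |q a - q' a| * r' a s') * c ∧
        -(q a * r a s' * (c * E s' G) + (q a * |r a s' - r' a s'| + |q a - q' a| * r' a s') * c) ≤
        q a * r a s' * E s' (fun τ => F (Traj.cons x a τ)) -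
        q' a * r' a s' * E' s' (fun τ => F (Traj.cons x a τ)) := by
      intro a s'
      rw [and_comm, ← abs_le]
      have h1 := ih (fun t => hPD t.succ) (fun t => hP t.succ) (fun t => hPD' t.succ)
        (fun t => hP' t.succ) (fun t => π t.succ) (s', d) (fun τ => hF (Traj.cons x a τ))
      have h2 := abs_trajExp_le (fun t => hPD' (Fin.succ t)) (fun t => hP' t.succ)
        (fun t => π t.succ) (s', d) (fun τ => hF (Traj.cons x a τ))
      change |E s' _ - E' s' _| ≤ c * E s' G at h1
      change |E' s' _| ≤ c at h2
      set u := E s' (fun τ => F (Traj.cons x a τ))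
      set v := E' s' (fun τ => F (Traj.cons x a τ))
      -- The first summand changes the model after the first step (induction hypothesis). The second
      -- changes it at the first step, in two stages: transition first, then action.
      have : q a * r a s' * u - q' a * r' a s' * v = q a * r a s' * (u - v) +
        (q a * (r a s' - r' a s') + (q a - q' a) * r' a s') * v := by ring
      rw [this]
      refine (abs_add_le _ _).trans (add_le_add ?_ ?_)
      · rw [abs_mul, abs_of_nonneg (mul_nonneg (q0 a) (r0 a s'))]
        exact mul_le_mul_of_nonneg_left h1 (mul_nonneg (q0 a) (r0 a s'))
      · rw [abs_mul]
        refine mul_le_mul ?_ h2 (abs_nonneg _) ?_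
        · refine (abs_add_le _ _).trans (le_of_eq ?_)
          rw [abs_mul, abs_mul, abs_of_nonneg (q0 a), abs_of_nonneg (r0' a s')]
        · exact add_nonneg (mul_nonneg (q0 a) (abs_nonneg _))
            (mul_nonneg (abs_nonneg _) (r0' a s'))
    have htot : ∑ a, ∑ s', (q a * r a s' * (c * E s' G) +
          (q a * |r a s' - r' a s'| + |q a - q' a| * r' a s') * c) =
        c * ∑ a, ∑ s', q a * r a s' * (E s' G +
          (∑ a, |q a - q' a| + ∑ s', |r a s' - r' a s'|)) := by
      -- Both `r a` and `r' a` have mass one, so the change of the action distribution counts the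
      -- same under either of them.
      have e1 : ∑ a, ∑ s', (q a * |r a s' - r' a s'| + |q a - q' a| * r' a s') =
          ∑ a, ∑ s', q a * r a s' * (∑ a, |q a - q' a| + ∑ s', |r a s' - r' a s'|) := by
        simp only [← Finset.sum_mul, ← Finset.mul_sum, Finset.sum_add_distrib, r1, r1', mul_one,
          mul_add, q1, one_mul]
        ring
      have e2 : ∀ a s', q a * r a s' * (c * E s' G) +
          (q a * |r a s' - r' a s'| + |q a - q' a| * r' a s') * c = c * (q a * r a s' * E s' G +
            (q a * |r a s' - r' a s'| + |q a - q' a| * r' a s')) := by intros; ring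
      simp only [e2, ← Finset.mul_sum, Finset.sum_add_distrib] at e1 ⊢
      simp only [mul_add (_ * _) (E _ G), Finset.sum_add_distrib, e1]
    rw [← htot, abs_le, ← Finset.sum_sub_distrib, ← Finset.sum_neg_distrib]
    simp_rw [← Finset.sum_sub_distrib, ← Finset.sum_neg_distrib]
    exact ⟨Finset.sum_le_sum fun a _ => Finset.sum_le_sum fun s' _ => (hstep a s').2,
      Finset.sum_le_sum fun a _ => Finset.sum_le_sum fun s' _ => (hstep a s').1⟩

end TrajExp

/-! ### Expectations over a run, and supermartingales -/

section RunExp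

/-- The data of a learning problem for several teams, together with the starts of the episodes and
the policies that are used in them. -/
structure Setting (S A : Type*) [Fintype S] [Fintype A] {N : ℕ} (D : Fin N → Type*) (L : ℕ) where
  pD : (i : Fin N) → S → D i → A → ℝ
  pD_mem : ∀ i s d, pD i s d ∈ stdSimplex ℝ A
  p : S → A → S → ℝ
  p_mem : ∀ s a, p s a ∈ stdSimplex ℝ S
  init : (k : ℕ) → History S A D L k → (i : Fin N) → S × D i
  π : (k : ℕ) → History S A D L k → (i : Fin N) → Policy S (D i) L

section History

variable {S A : Type*} {N : ℕ} {D : Fin N → Type*} {L : ℕ}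

/-- The first `k` episodes. -/
def History.take {k K : ℕ} (hk : k ≤ K) (h : History S A D L K) : History S A D L k :=
  fun j => h (Fin.castLE hk j)

/-- A history followed by one more episode of each team. -/
def History.snoc {k : ℕ} (h : History S A D L k) (e : (i : Fin N) → Traj S A (D i) L) :
    History S A D L (k + 1) :=
  Fin.snoc (α := fun _ => (i : Fin N) → Traj S A (D i) L) h e

@[simp] lemma History.snoc_last {k : ℕ} (h : History S A D L k)
    (e : (i : Fin N) → Traj S A (D i) L) : h.snoc e (Fin.last k) = e := by
  simp [History.snoc]

@[simp] lemma History.snoc_castSucc {k : ℕ} (h : History S A D L k)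
    (e : (i : Fin N) → Traj S A (D i) L) (l : Fin k) : h.snoc e l.castSucc = h l := by
  simp [History.snoc]

lemma History.take_snoc {k K : ℕ} (hk : k ≤ K) (h : History S A D L K)
    (e : (i : Fin N) → Traj S A (D i) L) :
    (h.snoc e).take (hk.trans K.le_succ) = h.take hk := by
  funext l
  exact h.snoc_castSucc e (Fin.castLE hk l)

lemma History.past_snoc_castSucc {K : ℕ} (h : History S A D L K)
    (e : (i : Fin N) → Traj S A (D i) L) (k : Fin K) :
    (h.snoc e).past k.castSucc = h.past k := h.take_snoc k.is_lt.le e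

lemma History.past_snoc_last {K : ℕ} (h : History S A D L K)
    (e : (i : Fin N) → Traj S A (D i) L) :
    (h.snoc e).past (Fin.last K) = h := h.take_snoc le_rfl e

end History

variable {S A : Type*} {N : ℕ} {D : Fin N → Type*} {L : ℕ}
variable [Fintype S] [Fintype A] [∀ i, Fintype (D i)]

lemma sum_history_succ {k : ℕ}
    (F : History S A D L (k + 1) → ℝ) :
    ∑ h, F h = ∑ h : History S A D L k, ∑ e : (i : Fin N) → Traj S A (D i) L, F (h.snoc e) := by
  rw [← (Fin.snocEquiv (fun _ : Fin (k + 1) => (i : Fin N) → Traj S A (D i) L)).sum_comp F,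
    Fintype.sum_prod_type, Finset.sum_comm]
  rfl

variable [DecidableEq S] [∀ i, DecidableEq (D i)]
variable (M : Setting S A D L)

/-- The probability that the next episodes of the teams are `e`, given the past `h`. -/
def epProb {k : ℕ} (h : History S A D L k) (e : (i : Fin N) → Traj S A (D i) L) : ℝ :=
  ∏ i, trajProb (fun _ => M.pD i) (fun _ => M.p) (M.π k h i) (M.init k h i) (e i)

/-- The expectation, given the past `h`, of a function of the next episodes of the teams. -/
def epExp {k : ℕ} (h : History S A D L k) (F : ((i : Fin N) → Traj S A (D i) L) → ℝ) : ℝ :=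
  ∑ e, epProb M h e * F e

/-- The expectation of a function of the run of `K` episodes for each team. -/
def runExp {K : ℕ} (F : History S A D L K → ℝ) : ℝ :=
  ∑ h, runProb M.pD M.p M.init M.π h * F h

lemma epProb_nonneg {k : ℕ} (h : History S A D L k) (e : (i : Fin N) → Traj S A (D i) L) :
    0 ≤ epProb M h e :=
  Finset.prod_nonneg fun i _ => trajProb_nonneg (fun _ s d => (M.pD_mem i s d).1)
    (fun _ s a => (M.p_mem s a).1) _ _ _

/-- Given the past, the episodes of the teams are independent. -/
lemma epExp_prod {k : ℕ} (h : History S A D L k) (G : (i : Fin N) → Traj S A (D i) L → ℝ) :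
    epExp M h (fun e => ∏ i, G i (e i)) =
      ∏ i, trajExp (fun _ => M.pD i) (fun _ => M.p) (M.π k h i) (M.init k h i) (G i) := by
  unfold epExp trajExp epProb
  rw [Finset.prod_univ_sum, Fintype.piFinset_univ]
  exact Finset.sum_congr rfl fun e _ => by rw [Finset.prod_mul_distrib]

lemma epExp_const {k : ℕ} (h : History S A D L k) (c : ℝ) : epExp M h (fun _ => c) = c := by
  have h1 : epExp M h (fun _ => 1) = 1 := by
    have := epExp_prod M h (fun _ _ => 1)
    simp only [Finset.prod_const_one] at this
    rw [this]
    exact Finset.prod_eq_one fun i _ => trajExp_const (fun _ s d => (M.pD_mem i s d).2)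
      (fun _ s a => (M.p_mem s a).2) _ _ 1
  simp only [epExp, mul_one] at h1 ⊢
  rw [← Finset.sum_mul, h1, one_mul]

lemma epExp_mono {k : ℕ} (h : History S A D L k) {F G : ((i : Fin N) → Traj S A (D i) L) → ℝ}
    (hFG : ∀ e, F e ≤ G e) : epExp M h F ≤ epExp M h G :=
  Finset.sum_le_sum fun e _ => mul_le_mul_of_nonneg_left (hFG e) (epProb_nonneg M h e)

lemma epExp_const_mul {k : ℕ} (h : History S A D L k) (c : ℝ)
    (F : ((i : Fin N) → Traj S A (D i) L) → ℝ) :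
    epExp M h (fun e => c * F e) = c * epExp M h F := by
  simp [epExp, Finset.mul_sum, mul_left_comm]

lemma epExp_add {k : ℕ} (h : History S A D L k) (F G : ((i : Fin N) → Traj S A (D i) L) → ℝ) :
    epExp M h (fun e => F e + G e) = epExp M h F + epExp M h G := by
  simp [epExp, mul_add, Finset.sum_add_distrib]

lemma epExp_sum {ι : Type*} (s : Finset ι) {k : ℕ} (h : History S A D L k)
    (F : ι → ((i : Fin N) → Traj S A (D i) L) → ℝ) :
    epExp M h (fun e => ∑ j ∈ s, F j e) = ∑ j ∈ s, epExp M h (F j) := by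
  simp only [epExp, Finset.mul_sum]
  exact Finset.sum_comm

/-- The episode of team `i` has the law given by `trajProb`. -/
lemma epExp_apply {k : ℕ} (h : History S A D L k) (i : Fin N) (G : Traj S A (D i) L → ℝ) :
    epExp M h (fun e => G (e i)) =
      trajExp (fun _ => M.pD i) (fun _ => M.p) (M.π k h i) (M.init k h i) G := by
  -- A product test function that is constantly one for the other teams picks out the marginal of
  -- team `i`.
  have key := epExp_prod M h (fun j τ => if hj : j = i then G (hj ▸ τ) else 1)
  rw [Finset.prod_eq_single i] at key
  · simp only [dif_pos] at key
    rw [← key]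
    refine Finset.sum_congr rfl fun e _ => ?_
    congr 1
    beta_reduce
    rw [Finset.prod_eq_single i]
    · simp
    · intro j _ hj; simp [hj]
    · simp
  · intro j _ hj
    simp only [dif_neg hj]
    exact trajExp_const (fun _ s d => (M.pD_mem j s d).2) (fun _ s a => (M.p_mem s a).2) _ _ 1
  · simp

lemma runProb_nonneg {K : ℕ} (h : History S A D L K) :
    0 ≤ runProb M.pD M.p M.init M.π h :=
  Finset.prod_nonneg fun k _ => epProb_nonneg M (h.past k) (h k)

lemma runProb_snoc {K : ℕ} (h : History S A D L K) (e : (i : Fin N) → Traj S A (D i) L) :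
    runProb M.pD M.p M.init M.π (h.snoc e) = runProb M.pD M.p M.init M.π h * epProb M h e := by
  change ∏ k : Fin (K + 1), epProb M ((h.snoc e).past k) ((h.snoc e) k) =
    (∏ k : Fin K, epProb M (h.past k) (h k)) * _
  rw [Fin.prod_univ_castSucc]
  congr 1
  · refine Finset.prod_congr rfl fun k _ => ?_
    rw [History.snoc_castSucc]
    exact congrArg (fun h' : History S A D L k => epProb M h' (h k)) (h.past_snoc_castSucc e k)
  · rw [History.snoc_last]
    exact congrArg (fun h' : History S A D L K => epProb M h' e) (h.past_snoc_last e)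

lemma runExp_succ {K : ℕ} (F : History S A D L (K + 1) → ℝ) :
    runExp M F = runExp M (fun h : History S A D L K => epExp M h fun e => F (h.snoc e)) := by
  unfold runExp epExp
  rw [sum_history_succ]
  refine Finset.sum_congr rfl fun h _ => ?_
  rw [Finset.mul_sum]
  exact Finset.sum_congr rfl fun e _ => by rw [runProb_snoc, mul_assoc]

lemma runExp_zero (F : History S A D L 0 → ℝ) : runExp M F = F Fin.elim0 := by
  unfold runExp
  rw [Fintype.sum_eq_single Fin.elim0]
  · simp [runProb]
  · intro h hh
    exact absurd (Subsingleton.elim _ _) hh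

lemma runExp_mono {K : ℕ} {F G : History S A D L K → ℝ} (h : ∀ x, F x ≤ G x) :
    runExp M F ≤ runExp M G :=
  Finset.sum_le_sum fun x _ => mul_le_mul_of_nonneg_left (h x) (runProb_nonneg M x)

lemma runExp_add {K : ℕ} (F G : History S A D L K → ℝ) :
    runExp M (fun h => F h + G h) = runExp M F + runExp M G := by
  simp [runExp, mul_add, Finset.sum_add_distrib]

lemma runExp_const_mul {K : ℕ} (c : ℝ) (F : History S A D L K → ℝ) :
    runExp M (fun h => c * F h) = c * runExp M F := by
  simp [runExp, Finset.mul_sum, mul_left_comm]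

lemma runExp_sum {ι : Type*} (s : Finset ι) {K : ℕ} (F : ι → History S A D L K → ℝ) :
    runExp M (fun h => ∑ j ∈ s, F j h) = ∑ j ∈ s, runExp M (F j) := by
  simp only [runExp, Finset.mul_sum]
  exact Finset.sum_comm

/-- The law of the first `k` episodes does not depend on the number of episodes. -/
lemma runExp_take {k K : ℕ} (hk : k ≤ K) (F : History S A D L k → ℝ) :
    runExp M (fun h : History S A D L K => F (h.take hk)) = runExp M F := by
  induction K, hk using Nat.le_induction with
  | base => rfl
  | succ K hk ih =>
    rw [runExp_succ, ← ih]
    refine congrArg (runExp M) (funext fun h => ?_)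
    simp_rw [History.take_snoc hk, epExp_const]

lemma runExp_const (K : ℕ) (c : ℝ) : runExp M (fun _ : History S A D L K => c) = c :=
  (runExp_take M K.zero_le (fun _ => c)).trans (runExp_zero M _)

/-- A product of nonnegative factors, one for each episode, has expectation at most `1` if each
factor has conditional expectation at most `1` given the past. -/
lemma runExp_prod_le_one
    (Ψ : (k : ℕ) → History S A D L k → ((i : Fin N) → Traj S A (D i) L) → ℝ)
    (h0 : ∀ k h e, 0 ≤ Ψ k h e) (h1 : ∀ k h, epExp M h (Ψ k h) ≤ 1) (K : ℕ) :
    runExp M (fun h : History S A D L K => ∏ k : Fin K, Ψ k (h.past k) (h k)) ≤ 1 := by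
  induction K with
  | zero => simp [runExp_zero]
  | succ K ih =>
    rw [runExp_succ]
    refine le_trans (runExp_mono M fun h => ?_) ih
    have : ∀ e, ∏ k : Fin (K + 1), Ψ k ((h.snoc e).past k) (h.snoc e k) =
        (∏ k : Fin K, Ψ k (h.past k) (h k)) * Ψ K h e := by
      intro e
      rw [Fin.prod_univ_castSucc]
      congr 1
      · refine Finset.prod_congr rfl fun k _ => ?_
        rw [History.snoc_castSucc]
        exact congrArg (fun h' : History S A D L k => Ψ k h' (h k)) (h.past_snoc_castSucc e k)
      · rw [History.snoc_last]
        exact congrArg (fun h' : History S A D L K => Ψ K h' e) (h.past_snoc_last e)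
    simp_rw [this]
    rw [epExp_const_mul]
    exact mul_le_of_le_one_right (Finset.prod_nonneg fun k _ => h0 _ _ _) (h1 K h)

/-- A product of nonnegative factors, one for each time step of each team, has expectation at most
`1` if each factor has conditional expectation at most `1` given the state and the agent. -/
lemma runExp_prod_prod_le_one {ψ : (i : Fin N) → S → D i → A → S → ℝ}
    (h0 : ∀ i s d a s', 0 ≤ ψ i s d a s')
    (h1 : ∀ i s d, ∑ a, ∑ s', M.pD i s d a * M.p s a s' * ψ i s d a s' ≤ 1) (k : ℕ) :
    runExp M (fun h : History S A D L k => ∏ l : Fin k, ∏ i, ∏ t, ψ i (Traj.state (h l i) t)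
      (Traj.switch (h l i) t) (Traj.action (h l i) t) (Traj.next (h l i) t)) ≤ 1 := by
  refine runExp_prod_le_one M (fun _ _ e => ∏ i, ∏ t, ψ i (Traj.state (e i) t)
      (Traj.switch (e i) t) (Traj.action (e i) t) (Traj.next (e i) t)) ?_ ?_ k
  · exact fun k h e => Finset.prod_nonneg fun i _ => Finset.prod_nonneg fun t _ => h0 _ _ _ _ _
  · intro k h
    rw [epExp_prod M h (fun i τ => ∏ t, ψ i (Traj.state τ t)
      (Traj.switch τ t) (Traj.action τ t) (Traj.next τ t))]
    refine Finset.prod_le_one (fun i _ => ?_) fun i _ => ?_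
    · exact Finset.sum_nonneg fun τ _ => mul_nonneg (trajProb_nonneg
        (fun _ s d => (M.pD_mem i s d).1) (fun _ s a => (M.p_mem s a).1) _ _ _)
        (Finset.prod_nonneg fun t _ => h0 _ _ _ _ _)
    · exact trajExp_prod_le_one (fun s d => (M.pD_mem i s d).1) (fun s a => (M.p_mem s a).1)
        (h0 i) (h1 i) _ _

/-- Sums of bounded nonnegative functions of the episodes control the sums of their conditional
expectations: exponential moment. -/
lemma runExp_exp_le_one {b : ℝ} (hb : 0 < b)
    (X : (k : ℕ) → History S A D L k → ((i : Fin N) → Traj S A (D i) L) → ℝ)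
    (h0 : ∀ k h e, 0 ≤ X k h e) (h1 : ∀ k h e, X k h e ≤ b) (K : ℕ) :
    runExp M (fun h : History S A D L K => Real.exp (∑ k : Fin K,
      (epExp M (h.past k) (X k (h.past k)) / (2 * b) - X k (h.past k) (h k) / b))) ≤ 1 := by
  simp_rw [Real.exp_sum]
  refine runExp_prod_le_one M (fun k h e => Real.exp (epExp M h (X k h) / (2 * b) - X k h e / b))
    (fun _ _ _ => (Real.exp_pos _).le) (fun k h => ?_) K
  set y := epExp M h (X k h) / (2 * b) with hy
  -- This is exp(-u) ≤ 1 - u/2 for u = X/b in [0, 1], a consequence of exp u ≥ 1 + u + u²/2 and (1 -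
  -- u/2)(1 + u + u²/2) = 1 + u/2 - u³/4. Its conditional expectation is 1 - y ≤ exp(-y), which
  -- compensates the factor exp y.
  have hle : ∀ e, Real.exp (y - X k h e / b) ≤ Real.exp y * (1 + (-(1 / (2 * b))) * X k h e) := by
    intro e
    rw [sub_eq_add_neg, Real.exp_add]
    refine mul_le_mul_of_nonneg_left ?_ (Real.exp_pos _).le
    set u := X k h e / b with hu
    have hu0 : 0 ≤ u := div_nonneg (h0 _ _ _) hb.le
    have hu1 : u ≤ 1 := (div_le_one hb).2 (h1 _ _ _)
    have hX : (-(1 / (2 * b))) * X k h e = -(u / 2) := by rw [hu]; field_simp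
    rw [hX]
    have h2 : Real.exp (-u) * (1 + u + u ^ 2 / 2) ≤ 1 := by
      rw [Real.exp_neg, inv_mul_le_iff₀ (Real.exp_pos _), mul_one]
      exact Real.quadratic_le_exp_of_nonneg hu0
    have h3 : 1 ≤ (1 - u / 2) * (1 + u + u ^ 2 / 2) := by
      nlinarith [mul_nonneg hu0 (mul_nonneg hu0 (sub_nonneg.2 hu1))]
    nlinarith [Real.exp_pos (-u), sq_nonneg u]
  refine (epExp_mono M h hle).trans ?_
  rw [epExp_const_mul, epExp_add, epExp_const, epExp_const_mul]
  have : -(1 / (2 * b)) * epExp M h (X k h) = -y := by rw [hy]; ring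
  rw [this]
  have h2 := Real.add_one_le_exp (-y)
  calc Real.exp y * (1 + -y) ≤ Real.exp y * Real.exp (-y) :=
        mul_le_mul_of_nonneg_left (by linarith) (Real.exp_pos _).le
    _ = 1 := by rw [← Real.exp_add]; simp

end RunExp

/-! ### Deviation of empirical frequencies in L¹ -/

section Concentration

open MeasureTheory ProbabilityTheory in
/-- Hoeffding's lemma for a Bernoulli random variable. -/
lemma hoeffding_bernoulli {q : ℝ} (h0 : 0 ≤ q) (h1 : q ≤ 1) (c : ℝ) :
    q * Real.exp (c * (1 - q)) + (1 - q) * Real.exp (c * (0 - q)) ≤ Real.exp (c ^ 2 / 8) := by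
  let μ : Measure Bool := ENNReal.ofReal q • Measure.dirac true +
    ENNReal.ofReal (1 - q) • Measure.dirac false
  have : IsProbabilityMeasure μ := ⟨by
    simp [μ, ← ENNReal.ofReal_add h0 (sub_nonneg.2 h1)]⟩
  let X : Bool → ℝ := fun b => if b then 1 else 0
  have hint : ∀ f : Bool → ℝ, ∫ b, f b ∂μ = q * f true + (1 - q) * f false := by
    intro f
    have := Measure.smul_finite (Measure.dirac true) (ENNReal.ofReal_ne_top (r := q))
    have := Measure.smul_finite (Measure.dirac false) (ENNReal.ofReal_ne_top (r := 1 - q))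
    rw [integral_add_measure Integrable.of_finite Integrable.of_finite, integral_smul_measure,
      integral_smul_measure, integral_dirac, integral_dirac, ENNReal.toReal_ofReal h0,
      ENNReal.toReal_ofReal (sub_nonneg.2 h1)]
    rfl
  have h := (hasSubgaussianMGF_of_mem_Icc (μ := μ) (X := X) (a := 0) (b := 1)
    (measurable_of_finite X).aemeasurable (Filter.Eventually.of_forall fun b => by
      cases b <;> simp [X])).mgf_le c
  rw [mgf, hint, hint] at h
  simp only [X, if_true, Bool.false_eq_true, if_false, mul_one, mul_zero, add_zero] at h
  refine h.trans (le_of_eq ?_)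
  congr 1
  simp
  ring

/-- The conditional exponential moment behind the deviation bounds for empirical frequencies. -/
lemma sum_mul_exp_le_one {O : Type*} [Fintype O] [DecidableEq O] {r : O → ℝ}
    (hr : r ∈ stdSimplex ℝ O) (B : Finset O) (c : ℝ) :
    ∑ o, r o * Real.exp (c * ((if o ∈ B then 1 else 0) - ∑ o ∈ B, r o) - c ^ 2 / 8) ≤ 1 := by
  set q := ∑ o ∈ B, r o with hq
  have hsplit : q + ∑ o ∈ Bᶜ, r o = 1 := by rw [hq, Finset.sum_add_sum_compl]; exact hr.2
  have h0 : 0 ≤ q := Finset.sum_nonneg fun o _ => hr.1 o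
  have h1 : q ≤ 1 := by
    have : 0 ≤ ∑ o ∈ Bᶜ, r o := Finset.sum_nonneg fun o _ => hr.1 o
    linarith
  rw [← Finset.sum_add_sum_compl B]
  have e1 : ∑ o ∈ B, r o * Real.exp (c * ((if o ∈ B then 1 else 0) - q) - c ^ 2 / 8) =
      q * Real.exp (c * (1 - q) - c ^ 2 / 8) := by
    conv_rhs => rw [hq, Finset.sum_mul]
    exact Finset.sum_congr rfl fun o ho => by rw [if_pos ho]
  have e2 : ∑ o ∈ Bᶜ, r o * Real.exp (c * ((if o ∈ B then 1 else 0) - q) - c ^ 2 / 8) =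
      (1 - q) * Real.exp (c * (0 - q) - c ^ 2 / 8) := by
    rw [← hsplit, add_sub_cancel_left, Finset.sum_mul]
    exact Finset.sum_congr rfl fun o ho => by rw [if_neg (Finset.mem_compl.1 ho)]
  rw [e1, e2, Real.exp_sub, Real.exp_sub, mul_div_assoc', mul_div_assoc', ← add_div,
    div_le_one (Real.exp_pos _)]
  exact hoeffding_bernoulli h0 h1 c

/-- The indicator of a proposition. -/
noncomputable def ind (P : Prop) : ℝ := open Classical in if P then 1 else 0

lemma ind_pos {P : Prop} (h : P) : ind P = 1 := if_pos h
lemma ind_neg {P : Prop} (h : ¬ P) : ind P = 0 := if_neg h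

lemma ind_nonneg (P : Prop) : 0 ≤ ind P := by
  by_cases h : P
  · rw [ind_pos h]; norm_num
  · rw [ind_neg h]

lemma ind_le_of_imp {P : Prop} {x : ℝ} (hx : 0 ≤ x) (h : P → 1 ≤ x) : ind P ≤ x := by
  by_cases hP : P
  · rw [ind_pos hP]; exact h hP
  · rw [ind_neg hP]; exact hx

/-- The positive and negative parts of a vector with sum zero have the same mass. This turns an L¹
deviation into the deviation of the mass of one subset. -/
lemma sum_abs_eq_two_mul {O : Type*} [Fintype O] {x : O → ℝ} (hx : ∑ o, x o = 0) :
    ∑ o, |x o| = 2 * ∑ o with 0 < x o, x o := by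
  have : ∀ o, |x o| = 2 * (if 0 < x o then x o else 0) - x o := by
    intro o
    split_ifs with h
    · rw [abs_of_pos h]; ring
    · rw [abs_of_nonpos (not_lt.1 h)]; ring
  rw [Finset.sum_congr rfl fun o _ => this o, Finset.sum_sub_distrib, hx, sub_zero,
    ← Finset.mul_sum, Finset.sum_filter]

/-- The `L¹` deviation inequality for empirical frequencies, from exponential moments. -/
lemma sum_ind_deviation_le {Ω O : Type*} [Fintype Ω] [Fintype O] [DecidableEq O] {w : Ω → ℝ}
    (hw : ∀ ω, 0 ≤ w ω) {r : O → ℝ} (hr : r ∈ stdSimplex ℝ O) {cnt : Ω → ℕ} {oc : Ω → O → ℕ}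
    (hoc : ∀ ω, ∑ o, oc ω o = cnt ω)
    (hexp : ∀ (B : Finset O) (c : ℝ), ∑ ω, w ω * Real.exp
      (c * (∑ o ∈ B, (oc ω o : ℝ) - cnt ω * ∑ o ∈ B, r o) - c ^ 2 / 8 * cnt ω) ≤ 1)
    {n : ℕ} (hn : 0 < n) {ε : ℝ} (hε : 0 ≤ ε) :
    ∑ ω, w ω * ind (cnt ω = n ∧ ε < ∑ o, |(oc ω o : ℝ) / cnt ω - r o|) ≤
      2 ^ Fintype.card O * Real.exp (-(n * ε ^ 2 / 2)) := by
  have hn' : (0 : ℝ) < n := Nat.cast_pos.2 hn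
  calc ∑ ω, w ω * ind (cnt ω = n ∧ ε < ∑ o, |(oc ω o : ℝ) / cnt ω - r o|)
      ≤ ∑ ω, w ω * ∑ B : Finset O, Real.exp (-(n * ε ^ 2 / 2)) * Real.exp
        -- The parameter c = 2ε is optimal: an L¹ deviation ε gives a subset with excess at least
        -- nε/2, so the exponent is at least nε² - nε²/2, which cancels the prefactor.
        ((2 * ε) * (∑ o ∈ B, (oc ω o : ℝ) - cnt ω * ∑ o ∈ B, r o) - (2 * ε) ^ 2 / 8 * cnt ω) := by
        refine Finset.sum_le_sum fun ω _ => mul_le_mul_of_nonneg_left ?_ (hw ω)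
        refine ind_le_of_imp (Finset.sum_nonneg fun B _ => by positivity) ?_
        rintro ⟨h1, h2⟩
        rw [h1] at h2
        have hz : ∑ o, ((oc ω o : ℝ) / n - r o) = 0 := by
          rw [Finset.sum_sub_distrib, ← Finset.sum_div, ← Nat.cast_sum, hoc, h1, hr.2,
            div_self hn'.ne', sub_self]
        rw [sum_abs_eq_two_mul hz] at h2
        -- The union bound over all subsets is needed because this one depends on the outcome.
        set B : Finset O := {o | 0 < (oc ω o : ℝ) / n - r o} with hB
        refine le_trans ?_ (Finset.single_le_sum (fun B _ => by positivity) (Finset.mem_univ B))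
        rw [← Real.exp_add, h1]
        refine Real.one_le_exp ?_
        rw [Finset.sum_sub_distrib, ← Finset.sum_div] at h2
        have h3 : n * ε / 2 ≤ ∑ o ∈ B, (oc ω o : ℝ) - n * ∑ o ∈ B, r o := by
          have : ∑ o ∈ B, (oc ω o : ℝ) - n * ∑ o ∈ B, r o =
              n * ((∑ o ∈ B, (oc ω o : ℝ)) / n - ∑ o ∈ B, r o) := by
            field_simp
          rw [this]
          nlinarith
        nlinarith [mul_le_mul_of_nonneg_left h3 (mul_nonneg zero_le_two hε)]
    _ = ∑ B : Finset O, Real.exp (-(n * ε ^ 2 / 2)) * ∑ ω, w ω * Real.exp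
        ((2 * ε) * (∑ o ∈ B, (oc ω o : ℝ) - cnt ω * ∑ o ∈ B, r o) -
          (2 * ε) ^ 2 / 8 * cnt ω) := by
        simp_rw [Finset.mul_sum]
        rw [Finset.sum_comm]
        exact Finset.sum_congr rfl fun B _ => Finset.sum_congr rfl fun ω _ => by ring
    _ ≤ ∑ B : Finset O, Real.exp (-(n * ε ^ 2 / 2)) :=
        Finset.sum_le_sum fun B _ => mul_le_of_le_one_right (Real.exp_pos _).le (hexp B _)
    _ = 2 ^ Fintype.card O * Real.exp (-(n * ε ^ 2 / 2)) := by
        rw [Finset.sum_const, Finset.card_univ, Fintype.card_finset, nsmul_eq_mul]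
        push_cast
        rfl

end Concentration

/-! ### Deviation inequalities for the visit counts -/

section Counts

variable {S A : Type*} {N : ℕ} {D : Fin N → Type*} {L : ℕ}
variable [Fintype S] [Fintype A] [∀ i, Fintype (D i)]
variable [DecidableEq S] [DecidableEq A] [∀ i, DecidableEq (D i)]
variable (M : Setting S A D L)

lemma sum_envNextCount {k : ℕ} (h : History S A D L k) (s : S) (a : A) :
    ∑ s', envNextCount h s a s' = envCount h s a := by
  unfold envNextCount envCount
  rw [Finset.sum_comm]
  refine Finset.sum_congr rfl fun l _ => ?_
  rw [Finset.sum_comm]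
  refine Finset.sum_congr rfl fun i _ => ?_
  rw [Finset.sum_comm]
  refine Finset.sum_congr rfl fun t _ => ?_
  by_cases h1 : Traj.state (h l i) t = s <;> by_cases h2 : Traj.action (h l i) t = a <;>
    simp [h1, h2]

lemma sum_agentActionCount {k : ℕ} (h : History S A D L k) (i : Fin N) (s : S) (d : D i) :
    ∑ a, agentActionCount h i s d a = agentCount h i s d := by
  unfold agentActionCount agentCount
  rw [Finset.sum_comm]
  refine Finset.sum_congr rfl fun l _ => ?_
  rw [Finset.sum_comm]
  refine Finset.sum_congr rfl fun t _ => ?_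
  by_cases h1 : Traj.state (h l i) t = s <;> by_cases h2 : Traj.switch (h l i) t = d <;>
    simp [h1, h2]

/-- The exponential is a product over all time steps of all teams, with factor one at steps that do
not visit `(s, a)`. Given the state and agent each factor has mean at most one, so no independence
of the random count is required. -/
lemma runExp_env_exp_le_one (s : S) (a : A) (B : Finset S) (c : ℝ) (k : ℕ) :
    runExp M (fun h : History S A D L k => Real.exp
      (c * (∑ s' ∈ B, (envNextCount h s a s' : ℝ) - envCount h s a * ∑ s' ∈ B, M.p s a s') -
        c ^ 2 / 8 * envCount h s a)) ≤ 1 := by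
  set f : S → ℝ := fun s' => c * ((if s' ∈ B then 1 else 0) - ∑ s' ∈ B, M.p s a s') - c ^ 2 / 8
    with hf
  have key := runExp_prod_prod_le_one M
    (ψ := fun _ s₁ _ a₁ s' => Real.exp (if s₁ = s ∧ a₁ = a then f s' else 0))
    (fun _ _ _ _ _ => (Real.exp_pos _).le) (fun i s₁ d => by
      have hin : ∀ a₁, ∑ s', M.p s₁ a₁ s' * Real.exp (if s₁ = s ∧ a₁ = a then f s' else 0) ≤ 1 := by
        intro a₁
        by_cases h : s₁ = s ∧ a₁ = a
        · simp only [h, and_self, if_true]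
          exact sum_mul_exp_le_one (M.p_mem s a) B c
        · simp only [h, if_false, Real.exp_zero, mul_one]
          exact (M.p_mem s₁ a₁).2.le
      simp_rw [mul_assoc, ← Finset.mul_sum]
      -- The next state is averaged first, for each action; the average over the actions is then
      -- trivial.
      calc _ ≤ ∑ a₁, M.pD i s₁ d a₁ * 1 := Finset.sum_le_sum fun a₁ _ =>
            mul_le_mul_of_nonneg_left (hin a₁) ((M.pD_mem i s₁ d).1 a₁)
        _ = 1 := by simp_rw [mul_one]; exact (M.pD_mem i s₁ d).2) k
  refine le_trans (le_of_eq (congrArg (runExp M) (funext fun h => ?_))) key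
  simp_rw [← Real.exp_sum]
  congr 1
  have hB : ∑ s' ∈ B, (envNextCount h s a s' : ℝ) = ∑ l, ∑ i, ∑ t,
      if Traj.state (h l i) t = s ∧ Traj.action (h l i) t = a then
        (if Traj.next (h l i) t ∈ B then (1 : ℝ) else 0) else 0 := by
    unfold envNextCount
    push_cast
    rw [Finset.sum_comm]
    refine Finset.sum_congr rfl fun l _ => ?_
    rw [Finset.sum_comm]
    refine Finset.sum_congr rfl fun i _ => ?_
    rw [Finset.sum_comm]
    refine Finset.sum_congr rfl fun t _ => ?_
    by_cases h1 : Traj.state (h l i) t = s <;> by_cases h2 : Traj.action (h l i) t = a <;>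
      simp [h1, h2]
  have hc : (envCount h s a : ℝ) = ∑ l, ∑ i, ∑ t,
      if Traj.state (h l i) t = s ∧ Traj.action (h l i) t = a then (1 : ℝ) else 0 := by
    unfold envCount
    push_cast
    rfl
  rw [hB, hc]
  have hterm : ∀ (l : Fin k) (i : Fin N) (t : Fin L),
      (if Traj.state (h l i) t = s ∧ Traj.action (h l i) t = a then
        f (Traj.next (h l i) t) else 0) =
      c * ((if Traj.state (h l i) t = s ∧ Traj.action (h l i) t = a then
        (if Traj.next (h l i) t ∈ B then (1 : ℝ) else 0) else 0) -
        (if Traj.state (h l i) t = s ∧ Traj.action (h l i) t = a then (1 : ℝ) else 0) *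
          ∑ s' ∈ B, M.p s a s') - c ^ 2 / 8 *
        (if Traj.state (h l i) t = s ∧ Traj.action (h l i) t = a then (1 : ℝ) else 0) := by
    intro l i t
    split_ifs <;> simp [*]
  simp only [hterm, Finset.sum_sub_distrib, ← Finset.mul_sum, ← Finset.sum_mul]

lemma runExp_agent_exp_le_one (i : Fin N) (s : S) (d : D i) (B : Finset A) (c : ℝ) (k : ℕ) :
    runExp M (fun h : History S A D L k => Real.exp
      (c * (∑ a ∈ B, (agentActionCount h i s d a : ℝ) -
          agentCount h i s d * ∑ a ∈ B, M.pD i s d a) -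
        c ^ 2 / 8 * agentCount h i s d)) ≤ 1 := by
  set f : A → ℝ := fun a => c * ((if a ∈ B then 1 else 0) - ∑ a ∈ B, M.pD i s d a) - c ^ 2 / 8
    with hf
  have key := runExp_prod_prod_le_one M
    -- Agents of different teams have different types, so they are compared as elements of the sigma
    -- type; the factor is one for every team other than `i`.
    (ψ := fun j s₁ d₁ a _ => Real.exp
      (if s₁ = s ∧ (⟨j, d₁⟩ : Σ j, D j) = ⟨i, d⟩ then f a else 0))
    (fun _ _ _ _ _ => (Real.exp_pos _).le) (fun j s₁ d₁ => by
      have hin : ∀ a, ∑ s', M.pD j s₁ d₁ a * M.p s₁ a s' * Real.exp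
          (if s₁ = s ∧ (⟨j, d₁⟩ : Σ j, D j) = ⟨i, d⟩ then f a else 0) =
          M.pD j s₁ d₁ a * Real.exp
          (if s₁ = s ∧ (⟨j, d₁⟩ : Σ j, D j) = ⟨i, d⟩ then f a else 0) := by
        intro a
        rw [← Finset.sum_mul, ← Finset.mul_sum, (M.p_mem s₁ a).2, mul_one]
      rw [Finset.sum_congr rfl fun a _ => hin a]
      by_cases h : s₁ = s ∧ (⟨j, d₁⟩ : Σ j, D j) = ⟨i, d⟩
      · simp only [if_pos h]
        obtain ⟨rfl, h⟩ := h
        cases h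
        exact sum_mul_exp_le_one (M.pD_mem i s₁ d) B c
      · simp only [h, if_false, Real.exp_zero, mul_one]
        exact (M.pD_mem j s₁ d₁).2.le) k
  refine le_trans (le_of_eq (congrArg (runExp M) (funext fun h => ?_))) key
  simp_rw [← Real.exp_sum]
  congr 1
  have hB : ∑ a ∈ B, (agentActionCount h i s d a : ℝ) = ∑ l, ∑ t,
      if Traj.state (h l i) t = s ∧ Traj.switch (h l i) t = d then
        (if Traj.action (h l i) t ∈ B then (1 : ℝ) else 0) else 0 := by
    unfold agentActionCount
    push_cast
    rw [Finset.sum_comm]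
    refine Finset.sum_congr rfl fun l _ => ?_
    rw [Finset.sum_comm]
    refine Finset.sum_congr rfl fun t _ => ?_
    by_cases h1 : Traj.state (h l i) t = s <;> by_cases h2 : Traj.switch (h l i) t = d <;>
      simp [h1, h2]
  have hc : (agentCount h i s d : ℝ) = ∑ l, ∑ t,
      if Traj.state (h l i) t = s ∧ Traj.switch (h l i) t = d then (1 : ℝ) else 0 := by
    unfold agentCount
    push_cast
    rfl
  rw [hB, hc]
  have hterm : ∀ (l : Fin k) (t : Fin L),
      (if Traj.state (h l i) t = s ∧ Traj.switch (h l i) t = d then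
        f (Traj.action (h l i) t) else 0) =
      c * ((if Traj.state (h l i) t = s ∧ Traj.switch (h l i) t = d then
        (if Traj.action (h l i) t ∈ B then (1 : ℝ) else 0) else 0) -
        (if Traj.state (h l i) t = s ∧ Traj.switch (h l i) t = d then (1 : ℝ) else 0) *
          ∑ a ∈ B, M.pD i s d a) - c ^ 2 / 8 *
        (if Traj.state (h l i) t = s ∧ Traj.switch (h l i) t = d then (1 : ℝ) else 0) := by
    intro l t
    split_ifs <;> simp [*]
  trans ∑ l, ∑ t, if Traj.state (h l i) t = s ∧ Traj.switch (h l i) t = d then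
        f (Traj.action (h l i) t) else 0
  · simp only [hterm, Finset.sum_sub_distrib, ← Finset.mul_sum, ← Finset.sum_mul]
  refine Finset.sum_congr rfl fun l _ => ?_
  rw [Finset.sum_eq_single i]
  · refine Finset.sum_congr rfl fun t _ => ?_
    have : ((⟨i, Traj.switch (h l i) t⟩ : Σ j, D j) = ⟨i, d⟩) ↔ Traj.switch (h l i) t = d := by
      simp
    simp only [this]
  · intro j _ hj
    refine Finset.sum_eq_zero fun t _ => ?_
    rw [if_neg]
    rintro ⟨_, h2⟩
    exact hj (congrArg Sigma.fst h2)
  · simp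

/-- The empirical transition probabilities deviate from the true ones by more than `ε`, with
exactly `n` observations. -/
lemma runExp_env_deviation_le (s : S) (a : A) (k : ℕ) {n : ℕ} (hn : 0 < n) {ε : ℝ}
    (hε : 0 ≤ ε) :
    runExp M (fun h : History S A D L k => ind (envCount h s a = n ∧
      ε < ∑ s', |envEmp h s a s' - M.p s a s'|)) ≤
      2 ^ Fintype.card S * Real.exp (-(n * ε ^ 2 / 2)) := by
  refine le_trans (le_of_eq ?_) (sum_ind_deviation_le (fun h => runProb_nonneg M h) (M.p_mem s a)
    (fun h => sum_envNextCount h s a) (fun B c => runExp_env_exp_le_one M s a B c k) hn hε)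
  refine Finset.sum_congr rfl fun h _ => ?_
  congr 1
  refine congrArg ind (propext (and_congr_right fun hcn => ?_))
  simp only [envEmp, hcn, hn.ne', if_false]

lemma runExp_agent_deviation_le (i : Fin N) (s : S) (d : D i) (k : ℕ) {n : ℕ} (hn : 0 < n) {ε : ℝ}
    (hε : 0 ≤ ε) :
    runExp M (fun h : History S A D L k => ind (agentCount h i s d = n ∧
      ε < ∑ a, |agentEmp h i s d a - M.pD i s d a|)) ≤
      2 ^ Fintype.card A * Real.exp (-(n * ε ^ 2 / 2)) := by
  refine le_trans (le_of_eq ?_) (sum_ind_deviation_le (fun h => runProb_nonneg M h)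
    (M.pD_mem i s d) (fun h => sum_agentActionCount h i s d)
    (fun B c => runExp_agent_exp_le_one M i s d B c k) hn hε)
  refine Finset.sum_congr rfl fun h _ => ?_
  congr 1
  refine congrArg ind (propext (and_congr_right fun hcn => ?_))
  simp only [agentEmp, hcn, hn.ne', if_false]

end Counts

/-! ### Pigeonhole principle with delayed updates -/

section Pigeonhole

/-- One step of a potential argument, with potential 2 min(V, 2m) + 6√c √V of the count V. While V <
m, the width bound 2 is paid by the first term, as V + v < 2m. Once V ≥ m, an increment v ≤ m at
most doubles V, so v/√V is at most 3(√(V + v) - √V), which the second term pays. -/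
lemma mul_min_le_of_le {v V m c : ℝ} (hv : 0 ≤ v) (hvm : v ≤ m) (hV : 0 ≤ V) (hc : 0 ≤ c) :
    v * min 2 (2 * Real.sqrt (c / max 1 V)) + (2 * min V (2 * m) + 6 * Real.sqrt c * Real.sqrt V) ≤
      2 * min (V + v) (2 * m) + 6 * Real.sqrt c * Real.sqrt (V + v) := by
  have hsc := Real.sqrt_nonneg c
  rcases lt_or_ge V m with h | h
  · have h1 : min V (2 * m) = V := min_eq_left (by linarith)
    have h2 : min (V + v) (2 * m) = V + v := min_eq_left (by linarith)
    have h3 : Real.sqrt V ≤ Real.sqrt (V + v) := Real.sqrt_le_sqrt (by linarith)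
    have h4 := mul_le_mul_of_nonneg_left h3 hsc
    have h5 := mul_le_mul_of_nonneg_left (min_le_left 2 (2 * Real.sqrt (c / max 1 V))) hv
    rw [h1, h2]
    linarith
  · have h1 : min V (2 * m) ≤ min (V + v) (2 * m) := min_le_min_right _ (by linarith)
    suffices v * min 2 (2 * Real.sqrt (c / max 1 V)) + 6 * Real.sqrt c * Real.sqrt V ≤
        6 * Real.sqrt c * Real.sqrt (V + v) by linarith
    rcases hv.eq_or_lt with rfl | hv'
    · simp
    have hVpos : 0 < V := by linarith
    set x := Real.sqrt V with hx
    set y := Real.sqrt (V + v) with hy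
    have hx0 : 0 < x := Real.sqrt_pos.2 hVpos
    have hy0 : 0 ≤ y := Real.sqrt_nonneg _
    have hx2 : x ^ 2 = V := Real.sq_sqrt hV
    have hy2 : y ^ 2 = V + v := Real.sq_sqrt (by linarith)
    have hxy : y ≤ 2 * x := by
      refine abs_le_of_sq_le_sq' ?_ (by linarith) |>.2
      nlinarith
    have hr : Real.sqrt (c / max 1 V) ≤ Real.sqrt c / x := by
      rw [hx, ← Real.sqrt_div hc]
      exact Real.sqrt_le_sqrt (div_le_div_of_nonneg_left hc hVpos (le_max_right _ _))
    have hm : v * min 2 (2 * Real.sqrt (c / max 1 V)) ≤ v * (2 * (Real.sqrt c / x)) :=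
      mul_le_mul_of_nonneg_left ((min_le_right _ _).trans (by linarith)) hv
    have hv2 : v = (y - x) * (y + x) := by nlinarith
    have hle : v * (2 * (Real.sqrt c / x)) ≤ 6 * Real.sqrt c * (y - x) := by
      have hyx : 0 ≤ y - x := by
        by_contra hneg
        nlinarith
      have : v * (2 * (Real.sqrt c / x)) = (2 * Real.sqrt c * (y - x)) * ((y + x) / x) := by
        rw [hv2]; ring
      rw [this]
      have h3 : (y + x) / x ≤ 3 := by
        rw [div_le_iff₀ hx0]; linarith
      have := mul_le_mul_of_nonneg_left h3
        (mul_nonneg (mul_nonneg zero_le_two hsc) hyx)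
      linarith
    linarith

/-- The pigeonhole principle for confidence widths that are only updated between episodes. -/
lemma sum_mul_min_le {K : ℕ} (v : Fin K → ℕ) {m c : ℝ} (hv : ∀ k, (v k : ℝ) ≤ m) (hm : 0 ≤ m)
    (hc : 0 ≤ c) :
    ∑ k, (v k : ℝ) * min 2 (2 * Real.sqrt
      (c / max 1 ((∑ l : Fin k, v (Fin.castLE k.is_lt.le l) : ℕ) : ℝ))) ≤
      4 * m + 6 * Real.sqrt c * Real.sqrt (∑ k, v k : ℕ) := by
  suffices ∑ k, (v k : ℝ) * min 2 (2 * Real.sqrt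
      (c / max 1 ((∑ l : Fin k, v (Fin.castLE k.is_lt.le l) : ℕ) : ℝ))) ≤
      2 * min ((∑ k, v k : ℕ) : ℝ) (2 * m) + 6 * Real.sqrt c * Real.sqrt (∑ k, v k : ℕ) by
    have := min_le_right ((∑ k, v k : ℕ) : ℝ) (2 * m)
    linarith
  induction K with
  | zero =>
    simp [hm]
  | succ K ih =>
    rw [Fin.sum_univ_castSucc]
    have h1 := ih (fun k => v k.castSucc) fun k => hv _
    have h2 := mul_min_le_of_le (Nat.cast_nonneg (v (Fin.last K))) (hv (Fin.last K))
      (Nat.cast_nonneg (∑ k : Fin K, v k.castSucc)) hc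
    rw [← Nat.cast_add, add_comm (∑ k : Fin K, v k.castSucc), add_comm (v _),
      ← Fin.sum_univ_castSucc] at h2
    refine le_trans (add_le_add_left h1 _) ?_
    rw [add_comm]
    exact h2

end Pigeonhole

/-! ### Size of the logarithm in the radii -/

section Logarithms

/-- The argument is at most W⁷ 2^(n+1) with W = s d' K L / δ. As log 2 ≤ log W, its logarithm is at
most (n + 8) log W, and n + 8 ≤ 9n. -/
lemma log_radius_le {k K L s d d' n : ℕ} {δ : ℝ} (hδ : 0 < δ) (hδ1 : δ < 1) (hk : k ≤ K)
    (hd : d ≤ d') (hn : 1 ≤ n) (hl : Real.log 2 ≤ Real.log (s * d' * (K * L : ℝ) / δ)) :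
    Real.log ((k : ℝ) ^ 7 * (L : ℝ) ^ 7 * s * d * 2 ^ (n + 1) / δ) ≤
      9 * n * Real.log (s * d' * (K * L : ℝ) / δ) := by
  set l := Real.log (s * d' * (K * L : ℝ) / δ) with hl'
  have hl0 : 0 < l := (Real.log_pos one_lt_two).trans_le hl
  have hn' : (1 : ℝ) ≤ n := by exact_mod_cast hn
  -- Here the argument is zero and `Real.log 0 = 0`. Thus the first episode, k = 0, satisfies the
  -- bound as well.
  by_cases h0 : k = 0 ∨ L = 0 ∨ s = 0 ∨ d = 0
  · have : Real.log ((k : ℝ) ^ 7 * (L : ℝ) ^ 7 * s * d * 2 ^ (n + 1) / δ) = 0 := by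
      rcases h0 with rfl | rfl | rfl | rfl <;> simp
    rw [this]; positivity
  · push Not at h0
    obtain ⟨k0, L0, s0, d0⟩ := h0
    have k1 : (1 : ℝ) ≤ k := by exact_mod_cast Nat.one_le_iff_ne_zero.2 k0
    have L1 : (1 : ℝ) ≤ L := by exact_mod_cast Nat.one_le_iff_ne_zero.2 L0
    have s1 : (1 : ℝ) ≤ s := by exact_mod_cast Nat.one_le_iff_ne_zero.2 s0
    have d1 : (1 : ℝ) ≤ d := by exact_mod_cast Nat.one_le_iff_ne_zero.2 d0
    have hkK : (k : ℝ) ≤ K := by exact_mod_cast hk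
    have hdd : (d : ℝ) ≤ d' := by exact_mod_cast hd
    have hKL : (k * L : ℝ) ≤ K * L := by gcongr
    have hkL1 : (1 : ℝ) ≤ k * L := one_le_mul_of_one_le_of_one_le k1 L1
    have hsd : (1 : ℝ) ≤ s * d := one_le_mul_of_one_le_of_one_le s1 d1
    have hδi : 1 ≤ 1 / δ := by rw [le_div_iff₀ hδ]; linarith
    have hle : (k : ℝ) ^ 7 * (L : ℝ) ^ 7 * s * d * 2 ^ (n + 1) / δ ≤
        (s * d' * (K * L : ℝ) / δ) ^ 7 * 2 ^ (n + 1) := by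
      have e1 : (s * d : ℝ) ≤ (s * d) ^ 7 := le_self_pow₀ hsd (by norm_num)
      have e2 : (1 / δ : ℝ) ≤ (1 / δ) ^ 7 := le_self_pow₀ hδi (by norm_num)
      calc (k : ℝ) ^ 7 * (L : ℝ) ^ 7 * s * d * 2 ^ (n + 1) / δ
          = (s * d) * (k * L) ^ 7 * (1 / δ) * 2 ^ (n + 1) := by ring
        _ ≤ (s * d) ^ 7 * (k * L) ^ 7 * (1 / δ) ^ 7 * 2 ^ (n + 1) := by gcongr
        _ = (s * d * (k * L) / δ) ^ 7 * 2 ^ (n + 1) := by ring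
        _ ≤ (s * d' * (K * L : ℝ) / δ) ^ 7 * 2 ^ (n + 1) := by gcongr
    have hpos : 0 < (k : ℝ) ^ 7 * (L : ℝ) ^ 7 * s * d * 2 ^ (n + 1) / δ := by positivity
    have hpos' : 0 < s * d' * (K * L : ℝ) / δ := by
      have : (0 : ℝ) < K := by linarith
      have : (0 : ℝ) < d' := by linarith
      positivity
    refine (Real.log_le_log hpos hle).trans ?_
    rw [Real.log_mul (by positivity) (by positivity), Real.log_pow, Real.log_pow, ← hl']
    push_cast
    have := mul_le_mul_of_nonneg_left hl (by linarith : (0 : ℝ) ≤ n + 1)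
    nlinarith

end Logarithms

/-! ### Bounds for costs and L¹ distances -/

section Episode

variable {S A D : Type*} {L : ℕ}

lemma cost_nonneg {C : Costs S A D} (hC : ∀ s a d d', 0 ≤ C.step s a d d') (τ : Traj S A D L) :
    0 ≤ Traj.cost C τ := Finset.sum_nonneg fun _ _ => hC _ _ _ _

lemma cost_le {C : Costs S A D} (hC : ∀ s a d d', C.step s a d d' ≤ 1) (τ : Traj S A D L) :
    Traj.cost C τ ≤ L := by
  refine (Finset.sum_le_sum fun t _ => hC _ _ _ _).trans ?_
  simp

lemma sum_abs_sub_le_two {O : Type*} [Fintype O] {q r : O → ℝ} (hq : q ∈ stdSimplex ℝ O)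
    (hr : r ∈ stdSimplex ℝ O) : ∑ o, |q o - r o| ≤ 2 := by
  calc ∑ o, |q o - r o| ≤ ∑ o, (q o + r o) := Finset.sum_le_sum fun o _ => by
        rw [abs_le]; constructor <;> linarith [hq.1 o, hr.1 o]
    _ = 2 := by rw [Finset.sum_add_distrib, hq.2, hr.2]; norm_num

lemma sum_abs_sub_le_add {O : Type*} [Fintype O] (q r u : O → ℝ) :
    ∑ o, |q o - u o| ≤ ∑ o, |r o - q o| + ∑ o, |u o - r o| := by
  rw [← Finset.sum_add_distrib]
  refine Finset.sum_le_sum fun o _ => ?_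
  rw [abs_sub_comm (r o), abs_sub_comm (u o)]
  exact abs_sub_le _ _ _

end Episode

/-! ### Regret of one optimistic episode -/

section Gap

variable {S A : Type*} {N : ℕ} {D : Fin N → Type*} {L : ℕ}
variable [Fintype S] [Fintype A] [∀ i, Fintype (D i)]
variable [DecidableEq S] [DecidableEq A] [∀ i, DecidableEq (D i)]

lemma envRadius_nonneg (δ : ℝ) {k : ℕ} (h : History S A D L k) (s : S) (a : A) :
    0 ≤ envRadius δ h s a := Real.sqrt_nonneg _

lemma agentRadius_nonneg (δ : ℝ) {k : ℕ} (h : History S A D L k) (i : Fin N) (s : S) (d : D i) :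
    0 ≤ agentRadius δ h i s d := Real.sqrt_nonneg _

lemma envEmp_mem [Nonempty S] {k : ℕ} (h : History S A D L k) (s : S) (a : A) :
    envEmp h s a ∈ stdSimplex ℝ S := by
  by_cases h0 : envCount h s a = 0
  · refine ⟨fun s' => ?_, ?_⟩
    · simp only [envEmp, h0, if_true]; positivity
    · simp [envEmp, h0]
  · refine ⟨fun s' => ?_, ?_⟩
    · simp only [envEmp, h0, if_false]; positivity
    · simp only [envEmp, h0, if_false]
      rw [← Finset.sum_div, ← Nat.cast_sum, sum_envNextCount, div_self (Nat.cast_ne_zero.2 h0)]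

lemma agentEmp_mem [Nonempty A] {k : ℕ} (h : History S A D L k) (i : Fin N) (s : S) (d : D i) :
    agentEmp h i s d ∈ stdSimplex ℝ A := by
  by_cases h0 : agentCount h i s d = 0
  · refine ⟨fun s' => ?_, ?_⟩
    · simp only [agentEmp, h0, if_true]; positivity
    · simp [agentEmp, h0]
  · refine ⟨fun s' => ?_, ?_⟩
    · simp only [agentEmp, h0, if_false]; positivity
    · simp only [agentEmp, h0, if_false]
      rw [← Finset.sum_div, ← Nat.cast_sum, sum_agentActionCount,
        div_self (Nat.cast_ne_zero.2 h0)]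

/-- The true agents' policies of team `i` lie in the confidence set. -/
def AgentGood (M : Setting S A D L) (δ : ℝ) {k : ℕ} (h : History S A D L k) (i : Fin N) : Prop :=
  ∀ s d, ∑ a, |agentEmp h i s d a - M.pD i s d a| ≤ agentRadius δ h i s d

/-- The true environment is at distance at most `ε` from the confidence set. -/
def EnvGood (M : Setting S A D L) (δ ε : ℝ) {k : ℕ} (h : History S A D L k) : Prop :=
  ∀ s a, ∑ s', |envEmp h s a s' - M.p s a s'| ≤ max (envRadius δ h s a) ε

/-- The sum of the widths of the confidence sets along an episode. -/
noncomputable def width (δ : ℝ) {k : ℕ} (h : History S A D L k) (i : Fin N)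
    (τ : Traj S A (D i) L) : ℝ :=
  ∑ t, (min 2 (2 * agentRadius δ h i (Traj.state τ t) (Traj.switch τ t)) +
    min 2 (2 * envRadius δ h (Traj.state τ t) (Traj.action τ t)))

lemma width_nonneg (δ : ℝ) {k : ℕ} (h : History S A D L k) (i : Fin N) (τ : Traj S A (D i) L) :
    0 ≤ width δ h i τ :=
  Finset.sum_nonneg fun _ _ => add_nonneg
    (le_min zero_le_two (mul_nonneg zero_le_two (agentRadius_nonneg δ h i _ _)))
    (le_min zero_le_two (mul_nonneg zero_le_two (envRadius_nonneg δ h _ _)))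

lemma width_le (δ : ℝ) {k : ℕ} (h : History S A D L k) (i : Fin N) (τ : Traj S A (D i) L) :
    width δ h i τ ≤ 4 * L := by
  calc width δ h i τ ≤ ∑ _t : Fin L, ((2 : ℝ) + 2) :=
        Finset.sum_le_sum fun _ _ => add_le_add (min_le_left _ _) (min_le_left _ _)
    _ = 4 * L := by simp; ring

variable (M : Setting S A D L) (C : (i : Fin N) → Costs S A (D i))

/-- The regret of team `i` in the next episode. -/
noncomputable def gap {k : ℕ} (h : History S A D L k) (i : Fin N) : ℝ :=
  expectedCost (C i) (fun _ => M.pD i) (fun _ => M.p) (M.π k h i) (M.init k h i) -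
    ⨅ π' : Policy S (D i) L, expectedCost (C i) (fun _ => M.pD i) (fun _ => M.p) π' (M.init k h i)

lemma exists_iInf_eq {k : ℕ} (h : History S A D L k) (i : Fin N) :
    ∃ π₀ : Policy S (D i) L,
      expectedCost (C i) (fun _ => M.pD i) (fun _ => M.p) π₀ (M.init k h i) =
      ⨅ π' : Policy S (D i) L,
        expectedCost (C i) (fun _ => M.pD i) (fun _ => M.p) π' (M.init k h i) :=
  have : Nonempty (Policy S (D i) L) := ⟨fun _ _ d => d⟩
  exists_eq_ciInf_of_finite

lemma gap_le {k : ℕ} (h : History S A D L k) (i : Fin N)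
    (hC : ∀ i s a d d', 0 ≤ (C i).step s a d d' ∧ (C i).step s a d d' ≤ 1) :
    gap M C h i ≤ L := by
  obtain ⟨π₀, h₀⟩ := exists_iInf_eq M C h i
  have mem := fun t : Fin L => M.pD_mem i
  have mem' := fun t : Fin L => M.p_mem
  have e1 : expectedCost (C i) (fun _ => M.pD i) (fun _ => M.p) (M.π k h i) (M.init k h i) ≤ L :=
    (le_abs_self _).trans (abs_trajExp_le mem mem' _ _ fun τ => by
      rw [abs_of_nonneg (cost_nonneg (fun s a d d' => (hC i s a d d').1) τ)]
      exact cost_le (fun s a d d' => (hC i s a d d').2) τ)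
  have e2 : 0 ≤ expectedCost (C i) (fun _ => M.pD i) (fun _ => M.p) π₀ (M.init k h i) :=
    Finset.sum_nonneg fun τ _ => mul_nonneg
      (trajProb_nonneg (fun _ s d => (M.pD_mem i s d).1) (fun _ s a => (M.p_mem s a).1) _ _ _)
      (cost_nonneg (fun s a d d' => (hC i s a d d').1) τ)
  unfold gap
  linarith

/-- The regret of an optimistic policy is at most the expected width of the confidence sets, up to
the distance of the true environment from its confidence set. -/
lemma gap_le_width {k : ℕ} (h : History S A D L k) (i : Fin N)
    (hC : ∀ i s a d d', 0 ≤ (C i).step s a d d' ∧ (C i).step s a d d' ≤ 1) {δ ε : ℝ}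
    (hε : 0 ≤ ε) (hopt : IsOptimistic C δ h i (M.init k h i) (M.π k h i))
    (hA : AgentGood M δ h i) (hE : EnvGood M δ ε h) :
    gap M C h i ≤ L * trajExp (fun _ => M.pD i) (fun _ => M.p) (M.π k h i) (M.init k h i)
      (width δ h i) + 2 * (L ^ 2 * ε) := by
  have : Nonempty S := ⟨(M.init k h i).1⟩
  have mem := fun t : Fin L => M.pD_mem i
  have mem' := fun t : Fin L => M.p_mem
  have hcost : ∀ τ : Traj S A (D i) L, |Traj.cost (C i) τ| ≤ L := fun τ => by
    rw [abs_of_nonneg (cost_nonneg (fun s a d d' => (hC i s a d d').1) τ)]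
    exact cost_le (fun s a d d' => (hC i s a d d').2) τ
  obtain ⟨PD, hPD, P, hP, hmin⟩ := hopt
  obtain ⟨π₀, h₀⟩ := exists_iInf_eq M C h i
  classical
  -- The true environment may lie outside the confidence set. Replacing its rows that are too far
  -- away by the empirical ones, which always belong to the set, gives a member at distance at most
  -- ε.
  let P' : S → A → S → ℝ := fun s a =>
    if ∑ s', |M.p s a s' - envEmp h s a s'| ≤ envRadius δ h s a then M.p s a else envEmp h s a
  have hP' : (fun _ : Fin L => P') ∈ envConf (D := D) δ h := by
    intro t s a
    by_cases hs : ∑ s', |M.p s a s' - envEmp h s a s'| ≤ envRadius δ h s a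
    · simp only [P', if_pos hs]
      exact ⟨M.p_mem s a, hs⟩
    · simp only [P', if_neg hs]
      exact ⟨envEmp_mem h s a, by simpa using envRadius_nonneg δ h s a⟩
  have hpP' : ∀ s a, ∑ s', |M.p s a s' - P' s a s'| ≤ ε := by
    intro s a
    by_cases hs : ∑ s', |M.p s a s' - envEmp h s a s'| ≤ envRadius δ h s a
    · simp only [P', if_pos hs]
      simpa using hε
    · simp only [P', if_neg hs]
      have := hE s a
      simp_rw [abs_sub_comm (envEmp h s a _)] at this
      exact (le_max_iff.1 this).resolve_left hs
  have hpD : (fun _ : Fin L => M.pD i) ∈ agentConf δ h i := by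
    intro t s d
    refine ⟨M.pD_mem i s d, ?_⟩
    simp_rw [abs_sub_comm (M.pD i s d _)]
    exact hA s d
  -- Optimism: the optimistic cost is at most the cost of an optimal policy under `P'`, which by
  -- `h2` and `h3` exceeds its true cost by at most L²ε.
  have h1 := hmin π₀ _ hpD _ hP'
  have h2 := abs_trajExp_sub_le mem mem' mem (fun t s a => (hP' t s a).1) π₀
    (M.init k h i) hcost
  have h3 : trajExp (fun _ => M.pD i) (fun _ => M.p) π₀ (M.init k h i) (fun τ => ∑ t : Fin L,
      (∑ a, |M.pD i (Traj.state τ t) (Traj.switch τ t) a -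
          M.pD i (Traj.state τ t) (Traj.switch τ t) a| +
        ∑ s', |M.p (Traj.state τ t) (Traj.action τ t) s' -
          P' (Traj.state τ t) (Traj.action τ t) s'|)) ≤ L * ε := by
    rw [← trajExp_const (fun t s d => (mem t s d).2) (fun t s a => (mem' t s a).2) π₀
      (M.init k h i) (L * ε)]
    refine trajExp_mono (fun t s d => (mem t s d).1) (fun t s a => (mem' t s a).1) _ _ fun τ => ?_
    calc _ ≤ ∑ _t : Fin L, ε := Finset.sum_le_sum fun t _ => by
          simpa using hpP' (Traj.state τ t) (Traj.action τ t)
      _ = L * ε := by simp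
  have h4 := abs_trajExp_sub_le mem mem' (fun t s d => (hPD t s d).1) (fun t s a => (hP t s a).1)
    (M.π k h i) (M.init k h i) hcost
  have h5 : trajExp (fun _ => M.pD i) (fun _ => M.p) (M.π k h i) (M.init k h i)
      (fun τ => ∑ t : Fin L,
      (∑ a, |M.pD i (Traj.state τ t) (Traj.switch τ t) a -
          PD t (Traj.state τ t) (Traj.switch τ t) a| +
        ∑ s', |M.p (Traj.state τ t) (Traj.action τ t) s' -
          P t (Traj.state τ t) (Traj.action τ t) s'|)) ≤
      trajExp (fun _ => M.pD i) (fun _ => M.p) (M.π k h i) (M.init k h i)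
        (width δ h i) + L * ε := by
    rw [← trajExp_const (fun t s d => (mem t s d).2) (fun t s a => (mem' t s a).2) (M.π k h i)
      (M.init k h i) (L * ε), ← trajExp_add]
    refine trajExp_mono (fun t s d => (mem t s d).1) (fun t s a => (mem' t s a).1) _ _ fun τ => ?_
    have : (L : ℝ) * ε = ∑ _t : Fin L, ε := by simp
    rw [this, width, ← Finset.sum_add_distrib]
    refine Finset.sum_le_sum fun t _ => ?_
    rw [add_assoc]
    refine add_le_add (le_min ?_ ?_) ?_
    · exact sum_abs_sub_le_two (M.pD_mem i _ _) (hPD t _ _).1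
    · refine (sum_abs_sub_le_add _ (agentEmp h i (Traj.state τ t) (Traj.switch τ t)) _).trans ?_
      linarith [hA (Traj.state τ t) (Traj.switch τ t),
        (hPD t (Traj.state τ t) (Traj.switch τ t)).2]
    -- The distance to the optimistic transition probabilities is at most radius + max(radius, ε),
    -- which gives the second ε per step.
    · rw [min_add]
      refine le_min ?_ ?_
      · linarith [sum_abs_sub_le_two (M.p_mem (Traj.state τ t) (Traj.action τ t))
          (hP t (Traj.state τ t) (Traj.action τ t)).1]
      · refine (sum_abs_sub_le_add _ (envEmp h (Traj.state τ t) (Traj.action τ t)) _).trans ?_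
        have hmax : max (envRadius δ h (Traj.state τ t) (Traj.action τ t)) ε ≤
            envRadius δ h (Traj.state τ t) (Traj.action τ t) + ε :=
          max_le (by linarith) (by
            linarith [envRadius_nonneg δ h (Traj.state τ t) (Traj.action τ t)])
        linarith [hE (Traj.state τ t) (Traj.action τ t),
          (hP t (Traj.state τ t) (Traj.action τ t)).2]
  have L0 : (0 : ℝ) ≤ L := Nat.cast_nonneg L
  have h6 := (abs_le.1 (h2.trans (mul_le_mul_of_nonneg_left h3 L0))).1
  have h7 := (abs_le.1 (h4.trans (mul_le_mul_of_nonneg_left h5 L0))).2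
  unfold gap
  rw [← h₀]
  simp only [expectedCost_eq_trajExp] at h1 ⊢
  nlinarith

end Gap

/-! ### Numerical tail estimates -/

section Tails

/-- Without observations the radius must cover any two distributions. They are at distance at most
2, and √(2 log X) ≥ 2 since X ≥ 8 > e² for at least two outcomes; with at most one outcome the
distance is zero. -/
lemma sum_abs_sub_le_sqrt {O : Type*} [Fintype O] {q r : O → ℝ} (hq : q ∈ stdSimplex ℝ O)
    (hr : r ∈ stdSimplex ℝ O) {X : ℝ} (hX : 2 ^ (Fintype.card O + 1) ≤ X) :
    ∑ o, |q o - r o| ≤ Real.sqrt (2 * Real.log X) := by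
  rcases Nat.lt_or_ge (Fintype.card O) 2 with h | h
  · have : Subsingleton O := Fintype.card_le_one_iff_subsingleton.1 (by omega)
    have heq : ∀ o, q o = r o := by
      intro o
      have h1 := hq.2
      have h2 := hr.2
      rw [Fintype.sum_subsingleton _ o] at h1 h2
      rw [h1, h2]
    simp only [heq, sub_self, abs_zero, Finset.sum_const_zero]
    exact Real.sqrt_nonneg _
  · refine (sum_abs_sub_le_two hq hr).trans (Real.le_sqrt_of_sq_le ?_)
    have h8 : (8 : ℝ) ≤ X := by
      refine le_trans ?_ hX
      calc (8 : ℝ) = 2 ^ 3 := by norm_num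
        _ ≤ 2 ^ (Fintype.card O + 1) := pow_le_pow_right₀ (by norm_num) (by omega)
    have he : Real.exp 2 ≤ X := by
      have h1 := Real.exp_one_lt_d9
      have h2 : Real.exp 2 = Real.exp 1 * Real.exp 1 := by rw [← Real.exp_add]; norm_num
      nlinarith [Real.exp_pos 1]
    have := (Real.le_log_iff_exp_le (by linarith)).2 he
    linarith

/-- A geometric tail, telescoped by means of exp u - 1 ≥ u. The bound does not depend on `m`, which
is what removes the number of teams from the union bound over pooled counts. -/
lemma sum_exp_neg_le {u : ℝ} (hu : 0 < u) {n m : ℕ} (h : n ≤ m) :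
    ∑ j ∈ Finset.Ioc n m, Real.exp (-(j * u)) ≤ Real.exp (-(n * u)) / u := by
  suffices ∑ j ∈ Finset.Ioc n m, Real.exp (-(j * u)) ≤
      (Real.exp (-(n * u)) - Real.exp (-(m * u))) / u from
    this.trans (div_le_div_of_nonneg_right (by linarith [Real.exp_pos (-(m * u))]) hu.le)
  induction m, h using Nat.le_induction with
  | base => simp
  | succ m hm ih =>
    rw [Finset.sum_Ioc_succ_top hm]
    have h1 : Real.exp (-((m + 1 : ℕ) * u)) * Real.exp u = Real.exp (-(m * u)) := by
      rw [← Real.exp_add]; congr 1; push_cast; ring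
    have h2 := Real.add_one_le_exp u
    have h3 : Real.exp (-((m + 1 : ℕ) * u)) ≤
        (Real.exp (-(m * u)) - Real.exp (-((m + 1 : ℕ) * u))) / u := by
      rw [le_div_iff₀ hu, ← h1]
      nlinarith [Real.exp_pos (-((m + 1 : ℕ) * u))]
    calc _ ≤ (Real.exp (-(n * u)) - Real.exp (-(m * u))) / u +
          (Real.exp (-(m * u)) - Real.exp (-((m + 1 : ℕ) * u))) / u := add_le_add ih h3
      _ = _ := by ring

lemma sum_one_div_sq_le (K : ℕ) :
    ∑ k ∈ Finset.Ico 1 K, 1 / (k : ℝ) ^ 2 ≤ 2 := by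
  suffices h : ∀ K : ℕ, ∑ k ∈ Finset.Ico 1 (K + 2), 1 / (k : ℝ) ^ 2 ≤ 2 - 1 / ((K : ℝ) + 1) by
    refine (Finset.sum_le_sum_of_subset_of_nonneg
      (Finset.Ico_subset_Ico_right (by omega : K ≤ K + 2)) fun _ _ _ => by positivity).trans
      ((h K).trans ?_)
    have h : (0 : ℝ) ≤ 1 / (K + 1) := by positivity
    linarith
  intro K
  induction K with
  | zero => norm_num
  | succ K ih =>
    rw [Finset.sum_Ico_succ_top (by omega)]
    have : 1 / ((K + 2 : ℕ) : ℝ) ^ 2 ≤ 1 / ((K : ℝ) + 1) - 1 / (((K + 1 : ℕ) : ℝ) + 1) := by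
      push_cast
      rw [div_sub_div _ _ (by positivity) (by positivity), div_le_div_iff₀ (by positivity)
        (by positivity)]
      nlinarith [(Nat.cast_nonneg K : (0 : ℝ) ≤ K)]
    linarith

/-- The radius is chosen so that the deviation bound at exactly n observations becomes 1/X, for
every n. -/
lemma exp_neg_mul_sqrt_sq {X : ℝ} (hX : 1 ≤ X) {n : ℕ} (hn : 0 < n) :
    Real.exp (-(n * Real.sqrt (2 * Real.log X / n) ^ 2 / 2)) = 1 / X := by
  have hn' : (0 : ℝ) < n := Nat.cast_pos.2 hn
  rw [Real.sq_sqrt (div_nonneg (mul_nonneg zero_le_two (Real.log_nonneg hX)) hn'.le)]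
  have : (n : ℝ) * (2 * Real.log X / n) / 2 = Real.log X := by field_simp
  rw [this, Real.exp_neg, Real.exp_log (by linarith), one_div]

end Tails

/-! ### Failure probabilities of the confidence sets -/

section Bad

variable {S A : Type*} {N : ℕ} {D : Fin N → Type*} {L : ℕ}
variable [Fintype S] [Fintype A] [∀ i, Fintype (D i)]
variable [DecidableEq S] [DecidableEq A] [∀ i, DecidableEq (D i)]
variable (M : Setting S A D L)

lemma sum_agentCount {k : ℕ} (h : History S A D L k) (i : Fin N) :
    ∑ s, ∑ d, agentCount h i s d = k * L := by
  unfold agentCount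
  have : ∀ l t, ∑ s, ∑ d, (if Traj.state (h l i) t = s ∧ Traj.switch (h l i) t = d then 1 else 0)
      = 1 := by
    intro l t
    simp only [ite_and]
    simp
  calc _ = ∑ l : Fin k, ∑ t : Fin L, ∑ s, ∑ d,
        (if Traj.state (h l i) t = s ∧ Traj.switch (h l i) t = d then 1 else 0) := by
        simp_rw [Finset.sum_comm (γ := Fin k), Finset.sum_comm (γ := Fin L)]
    _ = k * L := by simp_rw [this]; simp

lemma sum_envCount {k : ℕ} (h : History S A D L k) :
    ∑ s, ∑ a, envCount h s a = k * (N * L) := by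
  unfold envCount
  have : ∀ l i t, ∑ s, ∑ a,
      (if Traj.state (h l i) t = s ∧ Traj.action (h l i) t = a then 1 else 0) = 1 := by
    intro l i t
    simp only [ite_and]
    simp
  calc _ = ∑ l : Fin k, ∑ i, ∑ t : Fin L, ∑ s, ∑ a,
        (if Traj.state (h l i) t = s ∧ Traj.action (h l i) t = a then 1 else 0) := by
        simp_rw [Finset.sum_comm (γ := Fin k), Finset.sum_comm (γ := Fin N),
          Finset.sum_comm (γ := Fin L)]
    _ = k * (N * L) := by simp_rw [this]; simp

lemma agentCount_le {k : ℕ} (h : History S A D L k) (i : Fin N) (s : S) (d : D i) :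
    agentCount h i s d ≤ k * L := by
  rw [← sum_agentCount h i]
  exact (Finset.single_le_sum (f := fun d => agentCount h i s d) (fun _ _ => Nat.zero_le _)
    (Finset.mem_univ d)).trans (Finset.single_le_sum (f := fun s => ∑ d, agentCount h i s d)
    (fun _ _ => Nat.zero_le _) (Finset.mem_univ s))

lemma envCount_le {k : ℕ} (h : History S A D L k) (s : S) (a : A) :
    envCount h s a ≤ k * (N * L) := by
  rw [← sum_envCount h]
  exact (Finset.single_le_sum (f := fun a => envCount h s a) (fun _ _ => Nat.zero_le _)
    (Finset.mem_univ a)).trans (Finset.single_le_sum (f := fun s => ∑ a, envCount h s a)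
    (fun _ _ => Nat.zero_le _) (Finset.mem_univ s))

lemma two_pow_le_div {k L s a n : ℕ} {δ : ℝ} (hδ : 0 < δ) (hδ1 : δ < 1) (hk : 1 ≤ k)
    (hL : 1 ≤ L) (hs : 1 ≤ s) (ha : 1 ≤ a) :
    (2 : ℝ) ^ n ≤ (k : ℝ) ^ 7 * (L : ℝ) ^ 7 * s * a * 2 ^ n / δ := by
  have hk' : (1 : ℝ) ≤ k := by exact_mod_cast hk
  have hL' : (1 : ℝ) ≤ L := by exact_mod_cast hL
  have hs' : (1 : ℝ) ≤ s := by exact_mod_cast hs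
  have ha' : (1 : ℝ) ≤ a := by exact_mod_cast ha
  have h1 : (1 : ℝ) ≤ (k : ℝ) ^ 7 * (L : ℝ) ^ 7 * s * a :=
    one_le_mul_of_one_le_of_one_le (one_le_mul_of_one_le_of_one_le
      (one_le_mul_of_one_le_of_one_le (one_le_pow₀ hk') (one_le_pow₀ hL')) hs') ha'
  rw [le_div_iff₀ hδ]
  have h2 : (0 : ℝ) < 2 ^ n := by positivity
  nlinarith

/-- The probability that the confidence set of a team misses the true agents' policies. -/
lemma runExp_not_agentGood_le {δ : ℝ} (hδ : 0 < δ) (hδ1 : δ < 1) {k : ℕ} (hk : 1 ≤ k) (hL : 1 ≤ L)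
    (i : Fin N) :
    runExp M (fun h : History S A D L k => ind (¬ AgentGood M δ h i)) ≤ δ * (1 / (k : ℝ) ^ 2) := by
  obtain ⟨s₀, d₀⟩ := M.init 0 Fin.elim0 i
  have hA : Nonempty A := by
    by_contra hA
    rw [not_nonempty_iff] at hA
    simpa using (M.pD_mem i s₀ d₀).2
  have hS1 : 1 ≤ Fintype.card S := Fintype.card_pos_iff.2 ⟨s₀⟩
  have hD1 : 1 ≤ Fintype.card (D i) := Fintype.card_pos_iff.2 ⟨d₀⟩
  set X : ℝ := (k : ℝ) ^ 7 * (L : ℝ) ^ 7 * Fintype.card S * Fintype.card (D i) *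
    2 ^ (Fintype.card A + 1) / δ with hXdef
  have hX : 2 ^ (Fintype.card A + 1) ≤ X := two_pow_le_div hδ hδ1 hk hL hS1 hD1
  have hX1 : 1 ≤ X := (one_le_pow₀ one_le_two).trans hX
  -- A union bound over the pairs and over the exact value of the random count. A team's own count
  -- is at most kL, so the powers of k and L in X can pay for it.
  have hpt : ∀ h : History S A D L k, ind (¬ AgentGood M δ h i) ≤ ∑ s, ∑ d,
      ∑ n ∈ Finset.Icc 1 (k * L), ind (agentCount h i s d = n ∧
        Real.sqrt (2 * Real.log X / n) < ∑ a, |agentEmp h i s d a - M.pD i s d a|) := by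
    intro h
    have hnn : ∀ s d, 0 ≤ ∑ n ∈ Finset.Icc 1 (k * L), ind (agentCount h i s d = n ∧
        Real.sqrt (2 * Real.log X / n) < ∑ a, |agentEmp h i s d a - M.pD i s d a|) :=
      fun s d => Finset.sum_nonneg fun n _ => ind_nonneg _
    refine ind_le_of_imp (Finset.sum_nonneg fun s _ => Finset.sum_nonneg fun d _ => hnn s d) ?_
    intro hbad
    simp only [AgentGood, not_forall, not_le] at hbad
    obtain ⟨s, d, hsd⟩ := hbad
    refine le_trans ?_ (Finset.single_le_sum (f := fun s => ∑ d, ∑ n ∈ Finset.Icc 1 (k * L), _)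
      (fun s _ => Finset.sum_nonneg fun d _ => hnn s d) (Finset.mem_univ s))
    refine le_trans ?_ (Finset.single_le_sum (f := fun d => ∑ n ∈ Finset.Icc 1 (k * L), _)
      (fun d _ => hnn s d) (Finset.mem_univ d))
    unfold agentRadius at hsd
    rw [← hXdef] at hsd
    rcases Nat.eq_zero_or_pos (agentCount h i s d) with h0 | hpos
    · rw [h0] at hsd
      have := sum_abs_sub_le_sqrt (agentEmp_mem h i s d) (M.pD_mem i s d) hX
      simp only [Nat.cast_zero, zero_le_one, sup_of_le_left, div_one] at hsd
      linarith
    · rw [max_eq_right (by exact_mod_cast hpos)] at hsd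
      refine le_trans (le_of_eq ?_) (Finset.single_le_sum (fun n _ => ind_nonneg _)
        (Finset.mem_Icc.2 ⟨hpos, agentCount_le h i s d⟩))
      rw [ind_pos ⟨rfl, hsd⟩]
  refine (runExp_mono M hpt).trans ?_
  simp_rw [runExp_sum]
  calc _ ≤ ∑ _s : S, ∑ _d : D i, ∑ _n ∈ Finset.Icc 1 (k * L),
        (2 ^ Fintype.card A * (1 / X) : ℝ) := by
        refine Finset.sum_le_sum fun s _ => Finset.sum_le_sum fun d _ =>
          Finset.sum_le_sum fun n hn => ?_
        have hn0 : 0 < n := (Finset.mem_Icc.1 hn).1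
        refine (runExp_agent_deviation_le M i s d k hn0 (Real.sqrt_nonneg _)).trans (le_of_eq ?_)
        rw [exp_neg_mul_sqrt_sq hX1 hn0]
    _ = δ * (1 / (2 * (k : ℝ) ^ 6 * (L : ℝ) ^ 6)) := by
        simp only [Finset.sum_const, Finset.card_univ, Nat.card_Icc, nsmul_eq_mul]
        rw [hXdef]
        have h1 : (Fintype.card S : ℝ) ≠ 0 := by positivity
        have h2 : (Fintype.card (D i) : ℝ) ≠ 0 := by positivity
        have h3 : (k : ℝ) ≠ 0 := by positivity
        have h4 : (L : ℝ) ≠ 0 := by positivity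
        push_cast [Nat.add_sub_cancel]
        field_simp
        ring
    _ ≤ δ * (1 / (k : ℝ) ^ 2) := by
        refine mul_le_mul_of_nonneg_left ?_ hδ.le
        have hk' : (1 : ℝ) ≤ k := by exact_mod_cast hk
        have hL' : (1 : ℝ) ≤ L := by exact_mod_cast hL
        refine one_div_le_one_div_of_le (by positivity) ?_
        have h1 : (k : ℝ) ^ 2 ≤ (k : ℝ) ^ 6 := pow_le_pow_right₀ hk' (by norm_num)
        have h2 : (1 : ℝ) ≤ (L : ℝ) ^ 6 := one_le_pow₀ hL'
        nlinarith [pow_pos (by linarith : (0 : ℝ) < k) 2]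

/-- The probability that the true environment is further than `ε` from the shared confidence set.
The bound does not depend on the number of teams: counts above `n₀` only contribute through `ε`. -/
lemma runExp_not_envGood_le {δ ε : ℝ} (hδ : 0 < δ) (hδ1 : δ < 1) (hε : 0 < ε) {k : ℕ} (hk : 1 ≤ k)
    (hL : 1 ≤ L) [Nonempty S] [Nonempty A] (n₀ : ℕ) :
    runExp M (fun h : History S A D L k => ind (¬ EnvGood M δ ε h)) ≤
      n₀ * δ / (2 * (k : ℝ) ^ 7) + Fintype.card S * Fintype.card A * 2 ^ Fintype.card S *
        (Real.exp (-(n₀ * (ε ^ 2 / 2))) / (ε ^ 2 / 2)) := by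
  have hS1 : 1 ≤ Fintype.card S := Fintype.card_pos
  have hA1 : 1 ≤ Fintype.card A := Fintype.card_pos
  set X : ℝ := (k : ℝ) ^ 7 * (L : ℝ) ^ 7 * Fintype.card S * Fintype.card A *
    2 ^ (Fintype.card S + 1) / δ with hXdef
  have hX : 2 ^ (Fintype.card S + 1) ≤ X := two_pow_le_div hδ hδ1 hk hL hS1 hA1
  have hX1 : 1 ≤ X := (one_le_pow₀ one_le_two).trans hX
  -- The maximum only ensures n₀ ≤ m; pooled counts never exceed kNL.
  set m := max n₀ (k * (N * L)) with hm
  -- Up to n₀ observations the deviation is compared with the radius; beyond n₀ it is compared with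
  -- ε alone, so that the terms decay geometrically in n.
  let G : History S A D L k → S → A → ℝ := fun h s a =>
    ∑ n ∈ Finset.Ioc 0 n₀, ind (envCount h s a = n ∧
        Real.sqrt (2 * Real.log X / n) < ∑ s', |envEmp h s a s' - M.p s a s'|) +
      ∑ n ∈ Finset.Ioc n₀ m, ind (envCount h s a = n ∧
        ε < ∑ s', |envEmp h s a s' - M.p s a s'|)
  have hpt : ∀ h : History S A D L k, ind (¬ EnvGood M δ ε h) ≤ ∑ s, ∑ a, G h s a := by
    intro h
    have hnn1 : ∀ s a, 0 ≤ ∑ n ∈ Finset.Ioc 0 n₀, ind (envCount h s a = n ∧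
        Real.sqrt (2 * Real.log X / n) < ∑ s', |envEmp h s a s' - M.p s a s'|) :=
      fun s a => Finset.sum_nonneg fun n _ => ind_nonneg _
    have hnn2 : ∀ s a, 0 ≤ ∑ n ∈ Finset.Ioc n₀ m, ind (envCount h s a = n ∧
        ε < ∑ s', |envEmp h s a s' - M.p s a s'|) :=
      fun s a => Finset.sum_nonneg fun n _ => ind_nonneg _
    have hnn : ∀ s a, 0 ≤ G h s a := fun s a => add_nonneg (hnn1 s a) (hnn2 s a)
    refine ind_le_of_imp (Finset.sum_nonneg fun s _ => Finset.sum_nonneg fun a _ => hnn s a) ?_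
    intro hbad
    simp only [EnvGood, not_forall, not_le] at hbad
    obtain ⟨s, a, hsa⟩ := hbad
    obtain ⟨hsr, hse⟩ := max_lt_iff.1 hsa
    refine le_trans ?_ (Finset.single_le_sum (f := fun s => ∑ a, G h s a)
      (fun s _ => Finset.sum_nonneg fun a _ => hnn s a) (Finset.mem_univ s))
    refine le_trans ?_ (Finset.single_le_sum (f := fun a => G h s a)
      (fun a _ => hnn s a) (Finset.mem_univ a))
    unfold envRadius at hsr
    rw [← hXdef] at hsr
    rcases Nat.eq_zero_or_pos (envCount h s a) with h0 | hpos
    · rw [h0] at hsr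
      have := sum_abs_sub_le_sqrt (envEmp_mem h s a) (M.p_mem s a) hX
      simp only [Nat.cast_zero, zero_le_one, sup_of_le_left, div_one] at hsr
      linarith
    · rw [max_eq_right (by exact_mod_cast hpos)] at hsr
      rcases le_or_gt (envCount h s a) n₀ with hle | hgt
      · refine le_trans (le_of_eq ?_) ((Finset.single_le_sum (fun n _ => ind_nonneg _)
          (Finset.mem_Ioc.2 ⟨hpos, hle⟩)).trans (le_add_of_nonneg_right (hnn2 s a)))
        rw [ind_pos ⟨rfl, hsr⟩]
      · refine le_trans (le_of_eq ?_) ((Finset.single_le_sum (fun n _ => ind_nonneg _)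
          (Finset.mem_Ioc.2 ⟨hgt, (envCount_le h s a).trans (le_max_right _ _)⟩)).trans
          (le_add_of_nonneg_left (hnn1 s a)))
        rw [ind_pos ⟨rfl, hse⟩]
  refine (runExp_mono M hpt).trans ?_
  simp only [G, runExp_sum, runExp_add]
  have hterm1 : ∀ s a, ∀ n ∈ Finset.Ioc 0 n₀, runExp M (fun h : History S A D L k =>
      ind (envCount h s a = n ∧ Real.sqrt (2 * Real.log X / n) <
        ∑ s', |envEmp h s a s' - M.p s a s'|)) ≤ 2 ^ Fintype.card S * (1 / X) := by
    intro s a n hn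
    have hn0 : 0 < n := (Finset.mem_Ioc.1 hn).1
    refine (runExp_env_deviation_le M s a k hn0 (Real.sqrt_nonneg _)).trans (le_of_eq ?_)
    rw [exp_neg_mul_sqrt_sq hX1 hn0]
  have hterm2 : ∀ s a, ∀ n ∈ Finset.Ioc n₀ m, runExp M (fun h : History S A D L k =>
      ind (envCount h s a = n ∧ ε < ∑ s', |envEmp h s a s' - M.p s a s'|)) ≤
        2 ^ Fintype.card S * Real.exp (-(n * (ε ^ 2 / 2))) := by
    intro s a n hn
    have hn0 : 0 < n := (Nat.zero_le _).trans_lt (Finset.mem_Ioc.1 hn).1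
    refine (runExp_env_deviation_le M s a k hn0 hε.le).trans (le_of_eq ?_)
    rw [mul_div_assoc]
  calc _ ≤ ∑ _s : S, ∑ _a : A, (n₀ * (2 ^ Fintype.card S * (1 / X)) +
        2 ^ Fintype.card S * (Real.exp (-(n₀ * (ε ^ 2 / 2))) / (ε ^ 2 / 2)) : ℝ) := by
        refine Finset.sum_le_sum fun s _ => Finset.sum_le_sum fun a _ => add_le_add ?_ ?_
        · refine (Finset.sum_le_sum (hterm1 s a)).trans (le_of_eq ?_)
          simp
        · refine (Finset.sum_le_sum (hterm2 s a)).trans ?_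
          rw [← Finset.mul_sum]
          exact mul_le_mul_of_nonneg_left (sum_exp_neg_le (by positivity) (le_max_left _ _))
            (by positivity)
    _ = n₀ * δ / (2 * (k : ℝ) ^ 7 * (L : ℝ) ^ 7) +
        Fintype.card S * Fintype.card A * 2 ^ Fintype.card S *
        (Real.exp (-(n₀ * (ε ^ 2 / 2))) / (ε ^ 2 / 2)) := by
        simp only [Finset.sum_const, Finset.card_univ, nsmul_eq_mul]
        rw [mul_add, mul_add]
        congr 1
        · rw [hXdef]
          have h1 : (Fintype.card S : ℝ) ≠ 0 := by positivity
          have h2 : (Fintype.card A : ℝ) ≠ 0 := by positivity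
          have h3 : (k : ℝ) ≠ 0 := by positivity
          have h4 : (L : ℝ) ≠ 0 := by positivity
          field_simp
          ring
        · ring
    _ ≤ _ := by
        refine add_le_add_left ?_ _
        have hL' : (1 : ℝ) ≤ (L : ℝ) ^ 7 := one_le_pow₀ (by exact_mod_cast hL)
        have hk' : (0 : ℝ) < k := by exact_mod_cast hk
        exact div_le_div_of_nonneg_left (by positivity) (by positivity)
          (le_mul_of_one_le_right (by positivity) hL')

end Bad

/-! ### Observed widths and the regret decomposition -/

section WidthSums

lemma sum_sqrt_le {ι : Type*} [Fintype ι] (f : ι → ℕ) :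
    ∑ j, Real.sqrt (f j) ≤ Real.sqrt (Fintype.card ι * (∑ j, f j : ℕ)) := by
  refine Real.le_sqrt_of_sq_le ?_
  have h := sq_sum_le_card_mul_sum_sq (s := Finset.univ) (f := fun j => Real.sqrt (f j))
  simp only [Real.sq_sqrt (Nat.cast_nonneg _)] at h
  push_cast
  exact h

variable {S A : Type*} {N : ℕ} {D : Fin N → Type*} {L : ℕ}
variable [Fintype S] [Fintype A] [∀ i, Fintype (D i)]
variable [DecidableEq S] [DecidableEq A] [∀ i, DecidableEq (D i)]

/-- The steps are regrouped by the pair of state and agent. The pigeonhole principle applies to each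
pair with increments at most L, and Cauchy-Schwarz over the pairs uses that their counts add up to
KL. -/
lemma sum_agent_width_le {K : ℕ} (h : History S A D L K) (i : Fin N) {δ c : ℝ} (hc : 0 ≤ c)
    (hr : ∀ (k : Fin K) s d, agentRadius δ (h.past k) i s d ≤
      Real.sqrt (c / max 1 (agentCount (h.past k) i s d : ℝ))) :
    ∑ k : Fin K, ∑ t, min 2 (2 * agentRadius δ (h.past k) i (Traj.state (h k i) t)
      (Traj.switch (h k i) t)) ≤
      4 * (Fintype.card S * Fintype.card (D i) * L) +
        6 * Real.sqrt c * Real.sqrt (Fintype.card S * Fintype.card (D i) * (K * L)) := by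
  let v : S × D i → Fin K → ℕ := fun x k =>
    ∑ t, if Traj.state (h k i) t = x.1 ∧ Traj.switch (h k i) t = x.2 then 1 else 0
  have hv : ∀ x k, (v x k : ℝ) ≤ L := by
    intro x k
    have : v x k ≤ ∑ _t : Fin L, 1 := Finset.sum_le_sum fun t _ => by split_ifs <;> simp
    simp only [Finset.sum_const, Finset.card_univ, Fintype.card_fin, smul_eq_mul, mul_one] at this
    exact_mod_cast this
  calc ∑ k : Fin K, ∑ t, min 2 (2 * agentRadius δ (h.past k) i (Traj.state (h k i) t)
      (Traj.switch (h k i) t))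
      = ∑ k : Fin K, ∑ x : S × D i, (v x k : ℝ) *
          min 2 (2 * agentRadius δ (h.past k) i x.1 x.2) := by
        refine Finset.sum_congr rfl fun k _ => ?_
        simp only [v, Nat.cast_sum, Finset.sum_mul]
        rw [Finset.sum_comm]
        refine Finset.sum_congr rfl fun t _ => ?_
        rw [Finset.sum_eq_single (Traj.state (h k i) t, Traj.switch (h k i) t)]
        · simp
        · intro x _ hx
          rw [if_neg, Nat.cast_zero, zero_mul]
          rintro ⟨h1, h2⟩
          exact hx (Prod.ext h1.symm h2.symm)
        · simp
    _ ≤ ∑ x : S × D i, ∑ k : Fin K, (v x k : ℝ) * min 2 (2 * Real.sqrt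
          (c / max 1 ((∑ l : Fin k, v x (Fin.castLE k.is_lt.le l) : ℕ) : ℝ))) := by
        rw [Finset.sum_comm]
        refine Finset.sum_le_sum fun x _ => Finset.sum_le_sum fun k _ =>
          mul_le_mul_of_nonneg_left (min_le_min_left _ ?_) (Nat.cast_nonneg _)
        -- By definition, `agentCount (h.past k)` is the sum of the earlier values of `v x`.
        exact mul_le_mul_of_nonneg_left (hr k x.1 x.2) zero_le_two
    _ ≤ ∑ x : S × D i, (4 * (L : ℝ) + 6 * Real.sqrt c * Real.sqrt (∑ k, v x k : ℕ)) :=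
        Finset.sum_le_sum fun x _ => sum_mul_min_le (v x) (hv x) (Nat.cast_nonneg L) hc
    _ ≤ _ := by
        simp only [Finset.sum_add_distrib, ← Finset.mul_sum]
        have hcount : ∑ x : S × D i, ∑ k, v x k = K * L := by
          rw [Fintype.sum_prod_type]
          exact sum_agentCount h i
        have hs := sum_sqrt_le (fun x : S × D i => ∑ k, v x k)
        rw [hcount, Fintype.card_prod] at hs
        push_cast at hs ⊢
        refine add_le_add (le_of_eq ?_) (mul_le_mul_of_nonneg_left hs (by positivity))
        rw [Finset.sum_const, Finset.card_univ, Fintype.card_prod, nsmul_eq_mul]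
        push_cast
        ring

/-- As for the agents, but a pooled count can jump by NL between updates. The delay enters only the
term without a root of K, and pooling puts N under the root instead of in front of it. -/
lemma sum_env_width_le {K : ℕ} (h : History S A D L K) {δ c : ℝ} (hc : 0 ≤ c)
    (hr : ∀ (k : Fin K) s a, envRadius δ (h.past k) s a ≤
      Real.sqrt (c / max 1 (envCount (h.past k) s a : ℝ))) :
    ∑ k : Fin K, ∑ i, ∑ t, min 2 (2 * envRadius δ (h.past k) (Traj.state (h k i) t)
      (Traj.action (h k i) t)) ≤
      4 * (Fintype.card S * Fintype.card A * (N * L)) +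
        6 * Real.sqrt c * Real.sqrt (Fintype.card S * Fintype.card A * (K * (N * L))) := by
  let v : S × A → Fin K → ℕ := fun x k =>
    ∑ i, ∑ t, if Traj.state (h k i) t = x.1 ∧ Traj.action (h k i) t = x.2 then 1 else 0
  have hv : ∀ x k, (v x k : ℝ) ≤ N * L := by
    intro x k
    have : v x k ≤ ∑ _i : Fin N, ∑ _t : Fin L, 1 :=
      Finset.sum_le_sum fun i _ => Finset.sum_le_sum fun t _ => by split_ifs <;> simp
    simp only [Finset.sum_const, Finset.card_univ, Fintype.card_fin, smul_eq_mul, mul_one] at this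
    exact_mod_cast this
  calc ∑ k : Fin K, ∑ i, ∑ t, min 2 (2 * envRadius δ (h.past k) (Traj.state (h k i) t)
      (Traj.action (h k i) t))
      = ∑ k : Fin K, ∑ x : S × A, (v x k : ℝ) *
          min 2 (2 * envRadius δ (h.past k) x.1 x.2) := by
        refine Finset.sum_congr rfl fun k _ => ?_
        simp only [v, Nat.cast_sum, Finset.sum_mul]
        conv_rhs => rw [Finset.sum_comm]
        refine Finset.sum_congr rfl fun i _ => ?_
        conv_rhs => rw [Finset.sum_comm]
        refine Finset.sum_congr rfl fun t _ => ?_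
        rw [Finset.sum_eq_single (Traj.state (h k i) t, Traj.action (h k i) t)]
        · simp
        · intro x _ hx
          rw [if_neg, Nat.cast_zero, zero_mul]
          rintro ⟨h1, h2⟩
          exact hx (Prod.ext h1.symm h2.symm)
        · simp
    _ ≤ ∑ x : S × A, ∑ k : Fin K, (v x k : ℝ) * min 2 (2 * Real.sqrt
          (c / max 1 ((∑ l : Fin k, v x (Fin.castLE k.is_lt.le l) : ℕ) : ℝ))) := by
        rw [Finset.sum_comm]
        refine Finset.sum_le_sum fun x _ => Finset.sum_le_sum fun k _ =>
          mul_le_mul_of_nonneg_left (min_le_min_left _ ?_) (Nat.cast_nonneg _)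
        exact mul_le_mul_of_nonneg_left (hr k x.1 x.2) zero_le_two
    _ ≤ ∑ x : S × A, (4 * (N * L : ℝ) + 6 * Real.sqrt c * Real.sqrt (∑ k, v x k : ℕ)) :=
        Finset.sum_le_sum fun x _ => sum_mul_min_le (v x) (hv x) (by positivity) hc
    _ ≤ _ := by
        simp only [Finset.sum_add_distrib, ← Finset.mul_sum]
        have hcount : ∑ x : S × A, ∑ k, v x k = K * (N * L) := by
          rw [Fintype.sum_prod_type]
          exact sum_envCount h
        have hs := sum_sqrt_le (fun x : S × A => ∑ k, v x k)
        rw [hcount, Fintype.card_prod] at hs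
        push_cast at hs ⊢
        refine add_le_add (le_of_eq ?_) (mul_le_mul_of_nonneg_left hs (by positivity))
        rw [Finset.sum_const, Finset.card_univ, Fintype.card_prod, nsmul_eq_mul]
        push_cast
        ring

variable (M : Setting S A D L) (C : (i : Fin N) → Costs S A (D i))

/-- The number of episodes of the teams, except for the first ones, in which the true agents'
policies are not in the confidence set. -/
noncomputable def agentFailures (δ : ℝ) {K : ℕ} (h : History S A D L K) : ℝ :=
  ∑ k : Fin K, ∑ i, if 1 ≤ (k : ℕ) then ind (¬ AgentGood M δ (h.past k) i) else 0

/-- The total width of the confidence sets along the next episodes of the teams. -/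
noncomputable def totalWidth (δ : ℝ) {k : ℕ} (h : History S A D L k)
    (e : (i : Fin N) → Traj S A (D i) L) : ℝ :=
  ∑ i, width δ h i (e i)

lemma epExp_totalWidth (δ : ℝ) {k : ℕ} (h : History S A D L k) :
    epExp M h (totalWidth δ h) = ∑ i, trajExp (fun _ => M.pD i) (fun _ => M.p) (M.π k h i)
      (M.init k h i) (width δ h i) := by
  unfold totalWidth
  rw [epExp_sum]
  exact Finset.sum_congr rfl fun i _ => epExp_apply M h i _

lemma sum_totalWidth_le {K : ℕ} (h : History S A D L K) {δ c c' : ℝ} (hc : 0 ≤ c) (hc' : 0 ≤ c')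
    {d : ℕ} (hd : ∀ i, Fintype.card (D i) ≤ d)
    (hr : ∀ (k : Fin K) i s d, agentRadius δ (h.past k) i s d ≤
      Real.sqrt (c / max 1 (agentCount (h.past k) i s d : ℝ)))
    (hr' : ∀ (k : Fin K) s a, envRadius δ (h.past k) s a ≤
      Real.sqrt (c' / max 1 (envCount (h.past k) s a : ℝ))) :
    ∑ k : Fin K, totalWidth δ (h.past k) (h k) ≤
      N * (4 * (Fintype.card S * d * L) +
        6 * Real.sqrt c * Real.sqrt (Fintype.card S * d * (K * L))) +
      (4 * (Fintype.card S * Fintype.card A * (N * L)) +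
        6 * Real.sqrt c' * Real.sqrt (Fintype.card S * Fintype.card A * (K * (N * L)))) := by
  simp only [totalWidth, width, Finset.sum_add_distrib]
  refine add_le_add ?_ (sum_env_width_le h hc' hr')
  rw [Finset.sum_comm]
  refine (Finset.sum_le_sum fun i _ => (sum_agent_width_le h i hc fun k => hr k i).trans
    (?_ : _ ≤ 4 * (Fintype.card S * d * L : ℝ) +
        6 * Real.sqrt c * Real.sqrt (Fintype.card S * d * (K * L)))).trans (le_of_eq (by simp; ring))
  have hdi : (Fintype.card (D i) : ℝ) ≤ d := by exact_mod_cast hd i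
  gcongr

lemma regret_eq_sum_gap {K : ℕ} (h : History S A D L K) :
    regret C M.pD M.p M.init M.π h = ∑ i, ∑ k : Fin K, gap M C (h.past k) i := rfl

/-- The regret of a run in which the true environment is close to the shared confidence sets, from
the episode `k₀` on. -/
lemma regret_le_of_envGood {K : ℕ} (h : History S A D L K)
    (hC : ∀ i s a d d', 0 ≤ (C i).step s a d d' ∧ (C i).step s a d d' ≤ 1) {δ ε : ℝ}
    (hε : 0 ≤ ε) (hopt : IsSharedUCRL2MC C δ M.init M.π) {k₀ : ℕ} (hk₀ : 1 ≤ k₀)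
    (hE : ∀ k : Fin K, k₀ ≤ k → EnvGood M δ ε (h.past k)) :
    regret C M.pD M.p M.init M.π h ≤ N * L * k₀ + L * agentFailures M δ h +
      L * ∑ k : Fin K, epExp M (h.past k) (totalWidth δ (h.past k)) +
      2 * (N * K * L ^ 2 * ε) := by
  have L0 : (0 : ℝ) ≤ L := Nat.cast_nonneg L
  -- An early episode, or one whose agents' confidence set fails, is charged its maximal regret L;
  -- every other episode is charged its expected width and the slack.
  have hgap : ∀ (i : Fin N) (k : Fin K), gap M C (h.past k) i ≤
      L * (if (k : ℕ) < k₀ then 1 else 0) +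
      L * (if 1 ≤ (k : ℕ) then ind (¬ AgentGood M δ (h.past k) i) else 0) +
      L * trajExp (fun _ => M.pD i) (fun _ => M.p) (M.π k (h.past k) i) (M.init k (h.past k) i)
        (width δ (h.past k) i) + 2 * (L ^ 2 * ε) := by
    intro i k
    have hw : 0 ≤ trajExp (fun _ => M.pD i) (fun _ => M.p) (M.π k (h.past k) i)
        (M.init k (h.past k) i) (width δ (h.past k) i) :=
      Finset.sum_nonneg fun τ _ => mul_nonneg
        (trajProb_nonneg (fun _ s d => (M.pD_mem i s d).1) (fun _ s a => (M.p_mem s a).1) _ _ _)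
        (width_nonneg _ _ _ _)
    have hw' := mul_nonneg L0 hw
    have hε' : 0 ≤ (L : ℝ) ^ 2 * ε := by positivity
    have hi : 0 ≤ (L : ℝ) * (if 1 ≤ (k : ℕ) then ind (¬ AgentGood M δ (h.past k) i) else 0) := by
      refine mul_nonneg L0 ?_
      split_ifs
      · exact ind_nonneg _
      · exact le_rfl
    have hle := gap_le M C (h.past k) i hC
    rcases lt_or_ge (k : ℕ) k₀ with hk | hk
    · rw [if_pos hk]
      linarith
    · rw [if_neg (not_lt.2 hk)]
      by_cases hg : AgentGood M δ (h.past k) i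
      · have := gap_le_width M C (h.past k) i hC hε (hopt k (hk₀.trans hk) _ i) hg (hE k hk)
        linarith
      · rw [if_pos (hk₀.trans hk), ind_pos hg]
        linarith
  have hk₀' : ∑ k : Fin K, (if (k : ℕ) < k₀ then (1 : ℝ) else 0) ≤ k₀ := by
    rw [Fin.sum_univ_eq_sum_range (fun k => if k < k₀ then (1 : ℝ) else 0) K,
      ← Finset.sum_filter, Finset.sum_const, nsmul_eq_mul, mul_one]
    have : ((Finset.range K).filter (· < k₀)).card ≤ (Finset.range k₀).card :=
      Finset.card_le_card fun k hk => Finset.mem_range.2 (Finset.mem_filter.1 hk).2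
    rw [Finset.card_range] at this
    exact_mod_cast this
  rw [regret_eq_sum_gap]
  refine (Finset.sum_le_sum fun i _ => Finset.sum_le_sum fun k _ => hgap i k).trans ?_
  simp only [Finset.sum_add_distrib, ← Finset.mul_sum]
  have e1 : ∑ i : Fin N, ∑ k : Fin K, (if (k : ℕ) < k₀ then (1 : ℝ) else 0) =
      N * ∑ k : Fin K, (if (k : ℕ) < k₀ then (1 : ℝ) else 0) := by
    rw [Finset.sum_const, Finset.card_univ, Fintype.card_fin, nsmul_eq_mul]
  have e2 : ∑ i, ∑ k : Fin K,
      (if 1 ≤ (k : ℕ) then ind (¬ AgentGood M δ (h.past k) i) else 0) = agentFailures M δ h :=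
    Finset.sum_comm
  have e3 : ∑ i, ∑ k : Fin K, trajExp (fun _ => M.pD i) (fun _ => M.p) (M.π k (h.past k) i)
        (M.init k (h.past k) i) (width δ (h.past k) i) =
      ∑ k : Fin K, epExp M (h.past k) (totalWidth δ (h.past k)) := by
    rw [Finset.sum_comm]
    exact Finset.sum_congr rfl fun k _ => (epExp_totalWidth M δ _).symm
  have e4 : ∑ _i : Fin N, ∑ _k : Fin K, (2 * (L ^ 2 * ε) : ℝ) = 2 * (N * K * L ^ 2 * ε) := by
    simp
    ring
  rw [e1, e2, e3]
  simp only [Finset.sum_const, Finset.card_univ, Fintype.card_fin, nsmul_eq_mul] at e4 ⊢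
  have := mul_le_mul_of_nonneg_left hk₀' (mul_nonneg (Nat.cast_nonneg N : (0 : ℝ) ≤ N) L0)
  nlinarith

end WidthSums

/-! ### Probabilities of the agent and width events -/

section BadEvents

variable {S A : Type*} {N : ℕ} {D : Fin N → Type*} {L : ℕ}
variable [Fintype S] [Fintype A] [∀ i, Fintype (D i)]
variable [DecidableEq S] [DecidableEq A] [∀ i, DecidableEq (D i)]
variable (M : Setting S A D L)

lemma sum_fin_one_div_sq_le (K : ℕ) : ∑ k : Fin K, 1 / ((k : ℕ) : ℝ) ^ 2 ≤ 2 := by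
  rw [Fin.sum_univ_eq_sum_range (fun k => 1 / (k : ℝ) ^ 2) K]
  refine le_trans (le_of_eq ?_) (sum_one_div_sq_le K)
  rcases K with _ | K
  · simp
  · rw [Finset.range_eq_Ico, Finset.sum_eq_sum_Ico_succ_bot (Nat.succ_pos K)]
    simp

lemma runExp_past {K : ℕ} (k : Fin K) (F : History S A D L k → ℝ) :
    runExp M (fun h : History S A D L K => F (h.past k)) = runExp M F :=
  runExp_take M k.is_lt.le F

lemma runExp_agentFailures_le {δ : ℝ} (hδ : 0 < δ) (hδ1 : δ < 1) (hL : 1 ≤ L) (K : ℕ) :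
    runExp M (fun h : History S A D L K => agentFailures M δ h) ≤ 2 * N * δ := by
  unfold agentFailures
  simp only [runExp_sum]
  calc _ ≤ ∑ k : Fin K, ∑ _i : Fin N, δ * (1 / ((k : ℕ) : ℝ) ^ 2) := by
        refine Finset.sum_le_sum fun k _ => Finset.sum_le_sum fun i _ => ?_
        split_ifs with hk
        · exact (runExp_past M k fun h => ind (¬ AgentGood M δ h i)).trans_le
            (runExp_not_agentGood_le M hδ hδ1 hk hL i)
        · rw [runExp_const]
          positivity
    _ = N * δ * ∑ k : Fin K, 1 / ((k : ℕ) : ℝ) ^ 2 := by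
        simp only [Finset.sum_const, Finset.card_univ, Fintype.card_fin, nsmul_eq_mul,
          Finset.mul_sum, mul_assoc]
    _ ≤ N * δ * 2 := mul_le_mul_of_nonneg_left (sum_fin_one_div_sq_le K) (by positivity)
    _ = 2 * N * δ := by ring

/-- Markov's inequality with mean at most 2Nδ. Counting failures instead of excluding them avoids a
union bound over the teams. -/
lemma runExp_many_agentFailures_le {δ : ℝ} (hδ : 0 < δ) (hδ1 : δ < 1) (hL : 1 ≤ L) (hN : 1 ≤ N)
    (K : ℕ) :
    runExp M (fun h : History S A D L K => ind (8 * (N : ℝ) < agentFailures M δ h)) ≤ δ / 4 := by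
  have hN' : (0 : ℝ) < N := by exact_mod_cast hN
  have hpt : ∀ h : History S A D L K, ind (8 * (N : ℝ) < agentFailures M δ h) ≤
      1 / (8 * N) * agentFailures M δ h := by
    intro h
    have h0 : 0 ≤ agentFailures M δ h := Finset.sum_nonneg fun k _ => Finset.sum_nonneg fun i _ => by
      split_ifs
      · exact ind_nonneg _
      · exact le_rfl
    refine ind_le_of_imp (by positivity) fun hlt => ?_
    rw [one_div_mul_eq_div, le_div_iff₀ (by positivity)]
    linarith
  refine (runExp_mono M hpt).trans ?_
  rw [runExp_const_mul]
  calc _ ≤ 1 / (8 * (N : ℝ)) * (2 * N * δ) :=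
        mul_le_mul_of_nonneg_left (runExp_agentFailures_le M hδ hδ1 hL K) (by positivity)
    _ = δ / 4 := by field_simp; norm_num

/-- Markov's inequality for the exponential supermartingale with b = 4NL, the maximal total width of
a round of episodes; the threshold contains 2b log(4/δ). -/
lemma runExp_large_width_le {δ : ℝ} (hδ : 0 < δ) (hL : 1 ≤ L) (hN : 1 ≤ N) (K : ℕ) :
    runExp M (fun h : History S A D L K => ind
      (2 * ∑ k : Fin K, totalWidth δ (h.past k) (h k) + 8 * N * L * Real.log (4 / δ) <
        ∑ k : Fin K, epExp M (h.past k) (totalWidth δ (h.past k)))) ≤ δ / 4 := by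
  have hN' : (0 : ℝ) < N := by exact_mod_cast hN
  have hL' : (0 : ℝ) < L := by exact_mod_cast hL
  set b : ℝ := 4 * N * L with hb
  have hb0 : 0 < b := by positivity
  have key := runExp_exp_le_one M hb0 (fun k h e => totalWidth δ h e)
    (fun k h e => Finset.sum_nonneg fun i _ => width_nonneg _ _ _ _)
    (fun k h e => (Finset.sum_le_sum fun i _ => width_le _ _ _ _).trans (le_of_eq (by
      simp [hb]; ring))) K
  refine (runExp_mono M fun h => ?_).trans
    (((runExp_const_mul M (δ / 4) _).le).trans
      (mul_le_of_le_one_right (by positivity : (0 : ℝ) ≤ δ / 4) key))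
  refine ind_le_of_imp (by positivity) fun hlt => ?_
  rw [Finset.sum_sub_distrib, ← Finset.sum_div, ← Finset.sum_div]
  set X := ∑ k : Fin K, totalWidth δ (h.past k) (h k)
  have h1 : Real.log (4 / δ) ≤
      (∑ k : Fin K, epExp M (h.past k) (totalWidth δ (h.past k))) / (2 * b) - X / b := by
    rw [div_sub_div _ _ (by positivity) (by positivity), le_div_iff₀ (by positivity)]
    have : 2 * X + 2 * b * Real.log (4 / δ) <
      ∑ k : Fin K, epExp M (h.past k) (totalWidth δ (h.past k)) := by
      rw [hb]; linarith
    nlinarith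
  calc (1 : ℝ) = δ / 4 * Real.exp (Real.log (4 / δ)) := by
        rw [Real.exp_log (by positivity)]; field_simp
    _ ≤ _ := mul_le_mul_of_nonneg_left (Real.exp_le_exp.2 h1) (by positivity)

end BadEvents

/-! ### Arithmetic of the regret budget -/

section Budget

variable {K L s a d : ℕ} {δ B : ℝ}

/-- The assumption d ≥ 2 keeps the logarithm away from zero even when δ is close to 1 and all other
quantities are 1. -/
lemma log_two_le_log (hδ : 0 < δ) (hδ1 : δ < 1) (hL : 1 ≤ L) (hs : 1 ≤ s) (hd : 2 ≤ d)
    (hK : 1 ≤ K) : Real.log 2 ≤ Real.log (s * d * (K * L : ℝ) / δ) := by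
  have hL' : (1 : ℝ) ≤ L := by exact_mod_cast hL
  have hs' : (1 : ℝ) ≤ s := by exact_mod_cast hs
  have hd' : (2 : ℝ) ≤ d := by exact_mod_cast hd
  have hK' : (1 : ℝ) ≤ K := by exact_mod_cast hK
  refine Real.log_le_log two_pos ?_
  rw [le_div_iff₀ hδ]
  have h1 : (2 : ℝ) ≤ s * d := by nlinarith
  have h2 : (1 : ℝ) ≤ K * L := one_le_mul_of_one_le_of_one_le hK' hL'
  nlinarith

/-- The part of the regret budget that does not depend on the number of episodes. -/
lemma budget_le (hδ : 0 < δ) (hδ1 : δ < 1) (hL : 1 ≤ L) (hs : 1 ≤ s) (ha : 1 ≤ a) (hd : 2 ≤ d)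
    (hK : 1 ≤ K) (hB0 : 0 ≤ B)
    (hB : B ^ 2 = a * s * d * (K * L : ℝ) * Real.log (s * d * (K * L : ℝ) / δ))
    (hBK : 8 * B < K) :
    1 ≤ a * s * d * Real.log (s * d * (K * L : ℝ) / δ) ∧
      8 * (a * s * d * Real.log (s * d * (K * L : ℝ) / δ)) * L ≤ B := by
  have hl := log_two_le_log hδ hδ1 hL hs hd hK
  set l := Real.log (s * d * (K * L : ℝ) / δ)
  have hl2 := Real.log_two_gt_d9
  have hL' : (1 : ℝ) ≤ L := by exact_mod_cast hL
  have hs' : (1 : ℝ) ≤ s := by exact_mod_cast hs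
  have ha' : (1 : ℝ) ≤ a := by exact_mod_cast ha
  have hd' : (2 : ℝ) ≤ d := by exact_mod_cast hd
  have hK' : (1 : ℝ) ≤ K := by exact_mod_cast hK
  have has : (1 : ℝ) ≤ a * s := one_le_mul_of_one_le_of_one_le ha' hs'
  have hdl : (1 : ℝ) ≤ d * l := by nlinarith
  have hz : 1 ≤ a * s * d * l := by
    rw [mul_assoc (a * s : ℝ)]; exact one_le_mul_of_one_le_of_one_le has hdl
  refine ⟨hz, ?_⟩
  set z := a * s * d * l with hzdef
  have hB' : B ^ 2 = z * L * K := by rw [hB, hzdef]; ring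
  have hBpos : 0 < B := by
    rcases hB0.eq_or_lt with h | h
    · rw [← h] at hB'
      have : 0 < z * L * K := by positivity
      nlinarith
    · exact h
  have hzL : 0 < z * L := by positivity
  -- Here B² = zLK and K > 8B; cancelling B gives 8zL ≤ B.
  have h1 : z * L * (8 * B) ≤ B * B := by nlinarith
  have h2 : (z * L * 8) * B ≤ B * B := by linarith
  have := le_of_mul_le_mul_right h2 hBpos
  linarith

/-- With z = a s d log W one has ε² = z/(KL), so n₀ε²/2 is at least about B⁴z/(4KL) = z³KL/4 ≥ 8z.
Hence the exponential is at most a power W^-(6+a+s), which beats all polynomial factors and 2^s. -/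
lemma exp_tail_le (hδ : 0 < δ) (hδ1 : δ < 1) (hL : 1 ≤ L) (hs : 1 ≤ s) (ha : 1 ≤ a) (hd : 2 ≤ d)
    (hK : 1 ≤ K) (hB0 : 0 ≤ B)
    (hB : B ^ 2 = a * s * d * (K * L : ℝ) * Real.log (s * d * (K * L : ℝ) / δ))
    (hBK : 8 * B < K) :
    K * (s * a * 2 ^ s * (Real.exp (-((⌊B ^ 4⌋₊ : ℕ) * ((B / (K * L : ℝ)) ^ 2 / 2))) /
      ((B / (K * L : ℝ)) ^ 2 / 2))) ≤ δ / 8 := by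
  obtain ⟨hz, hzB⟩ := budget_le hδ hδ1 hL hs ha hd hK hB0 hB hBK
  have hl := log_two_le_log hδ hδ1 hL hs hd hK
  set l := Real.log (s * d * (K * L : ℝ) / δ) with hldef
  have hl0 : 0 < l := (Real.log_pos one_lt_two).trans_le hl
  have hL' : (1 : ℝ) ≤ L := by exact_mod_cast hL
  have hs' : (1 : ℝ) ≤ s := by exact_mod_cast hs
  have ha' : (1 : ℝ) ≤ a := by exact_mod_cast ha
  have hd' : (2 : ℝ) ≤ d := by exact_mod_cast hd
  have hK' : (1 : ℝ) ≤ K := by exact_mod_cast hK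
  set z := a * s * d * l with hzdef
  have hB' : B ^ 2 = z * (K * L) := by rw [hB, hzdef]; ring
  have hB8 : 8 * z ≤ B := le_trans (by nlinarith) hzB
  have hT : (1 : ℝ) ≤ K * L := one_le_mul_of_one_le_of_one_le hK' hL'
  have hu : (B / (K * L : ℝ)) ^ 2 / 2 = z / (2 * (K * L)) := by
    rw [div_pow, hB']; field_simp
  rw [hu]
  -- Since B ≥ 8, rounding down loses at most half.
  have hn : B ^ 4 / 2 ≤ (⌊B ^ 4⌋₊ : ℝ) := by
    have h1 := (Nat.lt_floor_add_one (B ^ 4)).le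
    have h2 : (8 : ℝ) ≤ B := by linarith
    have h3 : (2 : ℝ) ≤ B ^ 4 := by
      have : (8 : ℝ) ^ 4 ≤ B ^ 4 := by gcongr
      linarith
    linarith
  have hnu : 8 * z ≤ (⌊B ^ 4⌋₊ : ℝ) * (z / (2 * (K * L))) := by
    have h1 : B ^ 4 / 2 * (z / (2 * (K * L))) = z ^ 3 * (K * L) / 4 := by
      have : B ^ 4 = (z * (K * L)) ^ 2 := by rw [← hB']; ring
      rw [this]; field_simp; norm_num
    have h2 : B ^ 4 / 2 * (z / (2 * (K * L))) ≤ (⌊B ^ 4⌋₊ : ℝ) * (z / (2 * (K * L))) := by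
      gcongr
    rw [h1] at h2
    refine le_trans ?_ h2
    -- This follows from K > 8B ≥ 64z ≥ 64.
    have h3 : (32 : ℝ) ≤ K * L := by nlinarith
    have h4 : z ≤ z ^ 3 := le_self_pow₀ hz (by norm_num)
    nlinarith
  set W := s * d * (K * L : ℝ) / δ with hW
  have hW0 : 0 < W := by positivity
  have hexpl : Real.exp l = W := Real.exp_log hW0
  have hW2 : 2 ≤ W := by
    rw [← hexpl, ← Real.exp_log two_pos]; exact Real.exp_le_exp.2 hl
  have hexp : W ^ (6 + a + s) ≤ Real.exp (8 * z) := by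
    rw [← hexpl, ← Real.exp_nat_mul]
    refine Real.exp_le_exp.2 ?_
    push_cast
    have h1 : (6 + a + s : ℝ) ≤ 8 * (a * s * d) := by
      have : (a * s : ℝ) * 2 ≤ a * s * d := by gcongr
      nlinarith
    calc (6 + a + s : ℝ) * l ≤ 8 * (a * s * d) * l := by gcongr
      _ = 8 * z := by rw [hzdef]; ring
  -- The powers are spent as follows: δW² pays for K·s·(KL), W⁴ for 16, W^a for a and W^s for 2^s.
  have hfin : 16 * (K * (s * a * 2 ^ s) * (K * L)) ≤ δ * W ^ (6 + a + s) := by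
    have h1 : (K : ℝ) * s * (K * L) ≤ δ * W ^ 2 := by
      have : δ * W ^ 2 = (s * d * (K * L)) ^ 2 / δ := by rw [hW]; field_simp
      rw [this, le_div_iff₀ hδ]
      have e1 : (s : ℝ) ≤ s ^ 2 := le_self_pow₀ hs' (by norm_num)
      have e2 : (L : ℝ) ≤ L ^ 2 := le_self_pow₀ hL' (by norm_num)
      have e3 : (1 : ℝ) ≤ d ^ 2 := one_le_pow₀ (by linarith)
      calc (K : ℝ) * s * (K * L) * δ ≤ K * s * (K * L) * 1 := by gcongr
        _ = s * 1 * (K ^ 2 * L) := by ring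
        _ ≤ s ^ 2 * d ^ 2 * (K ^ 2 * L ^ 2) := by gcongr
        _ = (s * d * (K * L)) ^ 2 := by ring
    have h2 : (16 : ℝ) ≤ W ^ 4 := by
      calc (16 : ℝ) = 2 ^ 4 := by norm_num
        _ ≤ W ^ 4 := by gcongr
    have h3 : (a : ℝ) ≤ W ^ a := by
      calc (a : ℝ) ≤ 2 ^ a := by exact_mod_cast Nat.lt_two_pow_self.le
        _ ≤ W ^ a := by gcongr
    have h4 : (2 : ℝ) ^ s ≤ W ^ s := by gcongr
    calc (16 * (K * (s * a * 2 ^ s) * (K * L)) : ℝ) =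
          ((K : ℝ) * s * (K * L)) * 16 * a * 2 ^ s := by ring
      _ ≤ (δ * W ^ 2) * W ^ 4 * W ^ a * W ^ s := by gcongr
      _ = δ * W ^ (6 + a + s) := by rw [pow_add, pow_add]; ring
  have hz0 : 0 < z := by linarith
  have hquot : Real.exp (-((⌊B ^ 4⌋₊ : ℕ) * (z / (2 * (K * L))))) / (z / (2 * (K * L))) ≤
      2 * (K * L) / W ^ (6 + a + s) := by
    have e1 : Real.exp (-((⌊B ^ 4⌋₊ : ℕ) * (z / (2 * (K * L))))) ≤
        1 / W ^ (6 + a + s) := by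
      rw [Real.exp_neg, ← one_div]
      exact one_div_le_one_div_of_le (by positivity) (hexp.trans (Real.exp_le_exp.2 hnu))
    calc _ ≤ 1 / W ^ (6 + a + s) / (1 / (2 * (K * L))) := by
          gcongr
      _ = 2 * (K * L) / W ^ (6 + a + s) := by field_simp
  calc _ ≤ K * (s * a * 2 ^ s * (2 * (K * L) / W ^ (6 + a + s))) := by gcongr
    _ = (16 * (K * (s * a * 2 ^ s) * (K * L))) / (8 * W ^ (6 + a + s)) := by
        field_simp; norm_num
    _ ≤ (δ * W ^ (6 + a + s)) / (8 * W ^ (6 + a + s)) := by gcongr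
    _ = δ / 8 := by field_simp

lemma budget_sum_le {l : ℝ} (hL : 1 ≤ L) (hs : 1 ≤ s) (ha : 1 ≤ a) (hd : 2 ≤ d)
    (hl : Real.log 2 ≤ l) (hB : 8 * (a * s * d * l) * L ≤ B) (hz : 1 ≤ a * s * d * l) :
    9 + 8 * (s * d * L : ℝ) + 8 * (s * a * L) + 16 * (L * l) ≤ 6 * B := by
  have hl2 := Real.log_two_gt_d9
  have hl0 : 0 < l := (Real.log_pos one_lt_two).trans_le hl
  have hL' : (1 : ℝ) ≤ L := by exact_mod_cast hL
  have hs' : (1 : ℝ) ≤ s := by exact_mod_cast hs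
  have ha' : (1 : ℝ) ≤ a := by exact_mod_cast ha
  have hd' : (2 : ℝ) ≤ d := by exact_mod_cast hd
  have h1 : (s * d : ℝ) * 0.5 ≤ a * s * d * l := by
    calc (s * d : ℝ) * 0.5 ≤ (s * d : ℝ) * l :=
          mul_le_mul_of_nonneg_left (by linarith) (by positivity)
      _ ≤ (s * d : ℝ) * l * a := le_mul_of_one_le_right (by positivity) ha'
      _ = a * s * d * l := by ring
  have h2 : (s * a : ℝ) ≤ a * s * d * l := by
    calc (s * a : ℝ) ≤ (s * a : ℝ) * (d * l) :=
          le_mul_of_one_le_right (by positivity) (by nlinarith)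
      _ = a * s * d * l := by ring
  have h3 : 2 * l ≤ a * s * d * l := by
    have h4 := one_le_mul_of_one_le_of_one_le ha' hs'
    have : (2 : ℝ) ≤ a * s * d := by nlinarith
    exact mul_le_mul_of_nonneg_right this hl0.le
  have L0 : (0 : ℝ) ≤ L := by linarith
  have i1 := mul_le_mul_of_nonneg_right h1 L0
  have i2 := mul_le_mul_of_nonneg_right h2 L0
  have i3 := mul_le_mul_of_nonneg_right h3 L0
  have i4 : 1 * (L : ℝ) ≤ a * s * d * l * L := mul_le_mul_of_nonneg_right hz L0
  linarith

/-- The regret budget suffices. -/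
lemma total_le {N k₀ : ℕ} {F X Y ε : ℝ} (hδ : 0 < δ) (hδ1 : δ < 1) (hL : 1 ≤ L) (hs : 1 ≤ s)
    (ha : 1 ≤ a) (hd : 2 ≤ d) (hK : 1 ≤ K) (hB0 : 0 ≤ B)
    (hB : B ^ 2 = a * s * d * (K * L : ℝ) * Real.log (s * d * (K * L : ℝ) / δ))
    (hBK : 8 * B < K) (hk₀ : (k₀ : ℝ) ≤ B + 1) (hF : F ≤ 8 * N)
    (hY : Y ≤ 2 * X + 8 * N * L * Real.log (4 / δ)) (hε : ε = B / (K * L))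
    (hl' : 0 ≤ Real.log (s * a * (K * L : ℝ) / δ))
    (hX : X ≤ N * (4 * (s * d * L) +
        6 * Real.sqrt (18 * a * Real.log (s * d * (K * L : ℝ) / δ)) *
          Real.sqrt (s * d * (K * L))) +
      (4 * (s * a * (N * L)) +
        6 * Real.sqrt (18 * s * Real.log (s * a * (K * L : ℝ) / δ)) *
          Real.sqrt (s * a * (K * (N * L))))) :
    N * L * k₀ + L * F + L * Y + 2 * (N * K * L ^ 2 * ε) ≤
      64 * N * L * B + 64 * L * s *
        Real.sqrt (a * N * (K * L : ℝ) * Real.log (s * a * (K * L : ℝ) / δ)) := by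
  obtain ⟨hz, hzB⟩ := budget_le hδ hδ1 hL hs ha hd hK hB0 hB hBK
  have hl := log_two_le_log hδ hδ1 hL hs hd hK
  set W := s * d * (K * L : ℝ) / δ with hW
  set l := Real.log W with hldef
  set l' := Real.log (s * a * (K * L : ℝ) / δ)
  have hl2 := Real.log_two_gt_d9
  have hl0 : 0 < l := (Real.log_pos one_lt_two).trans_le hl
  have hL' : (1 : ℝ) ≤ L := by exact_mod_cast hL
  have hs' : (1 : ℝ) ≤ s := by exact_mod_cast hs
  have ha' : (1 : ℝ) ≤ a := by exact_mod_cast ha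
  have hd' : (2 : ℝ) ≤ d := by exact_mod_cast hd
  have hK' : (1 : ℝ) ≤ K := by exact_mod_cast hK
  have hN0 : (0 : ℝ) ≤ N := Nat.cast_nonneg N
  have hT : (1 : ℝ) ≤ K * L := one_le_mul_of_one_le_of_one_le hK' hL'
  -- The 18 is twice the constant 9 from `log_radius_le`. Altogether NLB gets the coefficient 1 + 51
  -- + 2 plus 6 from `budget_sum_le`, and the second term gets 2·6·4.25 = 51; both are below 64.
  have h18 : Real.sqrt 18 ≤ 4.25 := by
    rw [Real.sqrt_le_left (by norm_num)]; norm_num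
  have hagent : Real.sqrt (18 * a * l) * Real.sqrt (s * d * (K * L)) ≤ 4.25 * B := by
    rw [← Real.sqrt_mul (by positivity)]
    have : 18 * a * l * (s * d * (K * L)) = 18 * B ^ 2 := by rw [hB]; ring
    rw [this, Real.sqrt_mul (by norm_num), Real.sqrt_sq hB0]
    gcongr
  have henv : Real.sqrt (18 * s * l') * Real.sqrt (s * a * (K * (N * L))) ≤
      4.25 * (s * Real.sqrt (a * N * (K * L : ℝ) * l')) := by
    rw [← Real.sqrt_mul (by positivity)]
    have : 18 * s * l' * (s * a * (K * (N * L))) =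
        18 * (s ^ 2 * (a * N * (K * L : ℝ) * l')) := by ring
    rw [this, Real.sqrt_mul (by norm_num), Real.sqrt_mul (by positivity),
      Real.sqrt_sq (by positivity)]
    gcongr
  have hlog : Real.log (4 / δ) ≤ 2 * l := by
    have h1 : 2 / δ ≤ W := by
      rw [hW]
      have : (2 : ℝ) ≤ s * d := by nlinarith
      gcongr
      nlinarith
    have h2 : Real.log (2 / δ) ≤ l := Real.log_le_log (by positivity) h1
    have h3 : Real.log (4 / δ) = Real.log 2 + Real.log (2 / δ) := by
      rw [← Real.log_mul (by norm_num) (by positivity)]; congr 1; ring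
    linarith
  have hsum := budget_sum_le hL hs ha hd hl hzB hz
  have hεeq : N * K * L ^ 2 * ε = N * L * B := by
    rw [hε]; field_simp
  have hNL : (0 : ℝ) ≤ N * L := by positivity
  have hY' : L * Y ≤ 2 * (L * X) + 16 * (L * l) * (N * L) := by
    have h1 : 8 * N * L * Real.log (4 / δ) ≤ 8 * N * L * (2 * l) := by gcongr
    have h2 := mul_le_mul_of_nonneg_left (hY.trans (by linarith :
      _ ≤ 2 * X + 8 * N * L * (2 * l))) (by linarith : (0 : ℝ) ≤ L)
    linarith
  have hX' : L * X ≤ (N * L) * (4 * (s * d * L) + 6 * (4.25 * B)) +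
      (4 * (s * a * L) * (N * L) +
        L * (6 * (4.25 * (s * Real.sqrt (a * N * (K * L : ℝ) * l'))))) := by
    have h1 : X ≤ N * (4 * (s * d * L) + 6 * (4.25 * B)) + (4 * (s * a * (N * L)) +
        6 * (4.25 * (s * Real.sqrt (a * N * (K * L : ℝ) * l')))) := by
      refine hX.trans ?_
      rw [mul_assoc 6, mul_assoc 6]
      gcongr
    have h2 := mul_le_mul_of_nonneg_left h1 (by linarith : (0 : ℝ) ≤ L)
    linarith
  have hR : 0 ≤ L * (s * Real.sqrt (a * N * (K * L : ℝ) * l')) := by positivity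
  have i1 : (N * L : ℝ) * k₀ ≤ N * L * (B + 1) := mul_le_mul_of_nonneg_left hk₀ hNL
  have i2 : (L : ℝ) * F ≤ L * (8 * N) := mul_le_mul_of_nonneg_left hF (by linarith)
  have i3 := mul_le_mul_of_nonneg_left hsum hNL
  have i4 := mul_nonneg hNL hB0
  linarith

end Budget

/-! ### Assembling the high-probability bound -/

section Final

variable {S A : Type*} {N : ℕ} {D : Fin N → Type*} {L : ℕ}
variable [Fintype S] [Fintype A] [∀ i, Fintype (D i)]
variable [DecidableEq S] [DecidableEq A] [∀ i, DecidableEq (D i)]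
variable (M : Setting S A D L) (C : (i : Fin N) → Costs S A (D i))

lemma probability_eq_runExp {K : ℕ} (P : History S A D L K → Prop) :
    probability M.pD M.p M.init M.π {h | P h} = runExp M (fun h => ind (P h)) := by
  unfold probability runExp ind
  refine Finset.sum_congr rfl fun h _ => ?_
  by_cases hP : P h <;> simp [hP]

lemma probability_eq_one {K : ℕ} {P : History S A D L K → Prop} (h : ∀ x, P x) :
    probability M.pD M.p M.init M.π {h | P h} = 1 := by
  rw [probability_eq_runExp]
  simp_rw [ind_pos (h _)]
  exact runExp_const M K 1

lemma regret_le_trivial {K : ℕ} (h : History S A D L K)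
    (hC : ∀ i s a d d', 0 ≤ (C i).step s a d d' ∧ (C i).step s a d d' ≤ 1) :
    regret C M.pD M.p M.init M.π h ≤ N * (K * L) := by
  rw [regret_eq_sum_gap]
  refine (Finset.sum_le_sum fun i _ => Finset.sum_le_sum fun k _ =>
    gap_le M C (h.past k) i hC).trans (le_of_eq ?_)
  simp

lemma card_le_teamSize (i : Fin N) : Fintype.card (D i) ≤ teamSize D :=
  Finset.le_sup (f := fun i => Fintype.card (D i)) (Finset.mem_univ i)

lemma regret_eq_zero (hD : teamSize D ≤ 1) {K : ℕ} (h : History S A D L K) :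
    regret C M.pD M.p M.init M.π h = 0 := by
  rw [regret_eq_sum_gap]
  refine Finset.sum_eq_zero fun i _ => Finset.sum_eq_zero fun k _ => ?_
  have : Subsingleton (D i) :=
    Fintype.card_le_one_iff_subsingleton.1 ((card_le_teamSize i).trans hD)
  obtain ⟨π₀, h₀⟩ := exists_iInf_eq M C (h.past k) i
  unfold gap
  rw [← h₀, Subsingleton.elim π₀ (M.π k (h.past k) i), sub_self]

/-- From episode ⌈B⌉ on, n₀ ≤ B⁴ ≤ k⁴, so the small counts contribute at most δ/(2k³) ≤ (δ/16)/k²,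
with sum at most δ/8. The large counts contribute at most δ/8 over all episodes by `exp_tail_le`. -/
lemma runExp_env_failures_le [Nonempty S] [Nonempty A] {K d : ℕ} {δ B : ℝ} (hδ : 0 < δ)
    (hδ1 : δ < 1) (hL : 1 ≤ L) (hd : 2 ≤ d) (hK : 1 ≤ K) (hB0 : 0 ≤ B)
    (hB : B ^ 2 = Fintype.card A * Fintype.card S * d * (K * L : ℝ) *
      Real.log (Fintype.card S * d * (K * L : ℝ) / δ)) (hBK : 8 * B < K) :
    runExp M (fun h : History S A D L K => ∑ k : Fin K, if ⌈B⌉₊ ≤ (k : ℕ) then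
      ind (¬ EnvGood M δ (B / (K * L)) (h.past k)) else 0) ≤ δ / 4 := by
  have hs : 1 ≤ Fintype.card S := Fintype.card_pos
  have ha : 1 ≤ Fintype.card A := Fintype.card_pos
  have htail := exp_tail_le hδ hδ1 hL hs ha hd hK hB0 hB hBK
  obtain ⟨hz, hzB⟩ := budget_le hδ hδ1 hL hs ha hd hK hB0 hB hBK
  set z := Fintype.card A * Fintype.card S * d *
      Real.log (Fintype.card S * d * (K * L : ℝ) / δ)
  have hL' : (1 : ℝ) ≤ L := by exact_mod_cast hL
  have hK' : (1 : ℝ) ≤ K := by exact_mod_cast hK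
  have hB8 : 8 ≤ B := by nlinarith
  set n₀ := ⌊B ^ 4⌋₊
  set ε := B / (K * L) with hε
  have hε0 : 0 < ε := by positivity
  set tail := Fintype.card S * Fintype.card A * 2 ^ Fintype.card S *
        (Real.exp (-(n₀ * (ε ^ 2 / 2))) / (ε ^ 2 / 2))
  have htail0 : 0 ≤ tail := by positivity
  rw [runExp_sum]
  calc _ ≤ ∑ k : Fin K, (δ / 16 * (1 / ((k : ℕ) : ℝ) ^ 2) + tail) := by
        refine Finset.sum_le_sum fun k _ => ?_
        split_ifs with hk
        · have hkB : B ≤ (k : ℕ) := Nat.ceil_le.1 hk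
          have hk1 : 1 ≤ (k : ℕ) := by
            have : (1 : ℝ) ≤ (k : ℕ) := by linarith
            exact_mod_cast this
          refine ((runExp_past M k fun h => ind (¬ EnvGood M δ ε h)).trans_le
            (runExp_not_envGood_le M hδ hδ1 hε0 hk1 hL n₀)).trans ?_
          refine add_le_add_left ?_ _
          set x : ℝ := ((k : ℕ) : ℝ)
          have hx : 8 ≤ x := hB8.trans hkB
          have hn : (n₀ : ℝ) ≤ x ^ 4 := (Nat.floor_le (by positivity)).trans (by gcongr)
          calc n₀ * δ / (2 * x ^ 7) ≤ x ^ 4 * δ / (2 * x ^ 7) := by gcongr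
            _ = δ * (1 / (2 * x)) * (1 / x ^ 2) := by field_simp
            _ ≤ δ * (1 / (2 * 8)) * (1 / x ^ 2) := by gcongr
            _ = δ / 16 * (1 / x ^ 2) := by ring
        · rw [runExp_const]
          positivity
    _ = δ / 16 * ∑ k : Fin K, 1 / ((k : ℕ) : ℝ) ^ 2 + K * tail := by
        rw [Finset.sum_add_distrib, ← Finset.mul_sum]
        simp
    _ ≤ δ / 16 * 2 + δ / 8 := add_le_add
        (mul_le_mul_of_nonneg_left (sum_fin_one_div_sq_le K) (by positivity)) htail
    _ = δ / 4 := by ring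

/-- The regret bound when there are many episodes. -/
lemma one_sub_le_runExp {K d : ℕ} (hC : ∀ i s a d d', 0 ≤ (C i).step s a d d' ∧
      (C i).step s a d d' ≤ 1) {δ B : ℝ} (hδ : 0 < δ) (hδ1 : δ < 1)
    (hopt : IsSharedUCRL2MC C δ M.init M.π) (hN : 1 ≤ N) (hL : 1 ≤ L) (hd : 2 ≤ d)
    (hD : ∀ i, Fintype.card (D i) ≤ d) (hB0 : 0 ≤ B)
    (hB : B ^ 2 = Fintype.card A * Fintype.card S * d * (K * L : ℝ) *
      Real.log (Fintype.card S * d * (K * L : ℝ) / δ)) (hBK : 8 * B < K) :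
    1 - δ ≤ runExp M (fun h : History S A D L K => ind
      (regret C M.pD M.p M.init M.π h ≤ 64 * N * L * B + 64 * L * Fintype.card S *
        Real.sqrt (Fintype.card A * N * (K * L : ℝ) *
          Real.log (Fintype.card S * Fintype.card A * (K * L : ℝ) / δ)))) := by
  obtain ⟨s₀, d₀⟩ := M.init 0 Fin.elim0 ⟨0, hN⟩
  have : Nonempty S := ⟨s₀⟩
  have : Nonempty A := by
    by_contra hA
    rw [not_nonempty_iff] at hA
    simpa using (M.pD_mem _ s₀ d₀).2
  have hs : 1 ≤ Fintype.card S := Fintype.card_pos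
  have ha : 1 ≤ Fintype.card A := Fintype.card_pos
  have hK : 1 ≤ K := by
    have : (0 : ℝ) < K := by linarith
    exact_mod_cast this
  obtain ⟨hz, hzB⟩ := budget_le hδ hδ1 hL hs ha hd hK hB0 hB hBK
  have hL' : (1 : ℝ) ≤ L := by exact_mod_cast hL
  have hK' : (1 : ℝ) ≤ K := by exact_mod_cast hK
  have hB8 : 8 ≤ B := by nlinarith
  have hK2 : 2 ≤ K := by
    have : (2 : ℝ) ≤ K := by linarith
    exact_mod_cast this
  set l := Real.log (Fintype.card S * d * (K * L : ℝ) / δ)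
  set l' := Real.log (Fintype.card S * Fintype.card A * (K * L : ℝ) / δ) with hl'def
  have hl : Real.log 2 ≤ l := log_two_le_log hδ hδ1 hL hs hd hK
  have hl' : Real.log 2 ≤ l' := by
    -- There may be just one state and one action, so K ≥ 2 takes the role of the factor that must
    -- be at least 2.
    have h := log_two_le_log (s := Fintype.card S * Fintype.card A) hδ hδ1 hL
      (Nat.mul_pos hs ha) hK2 (le_refl 1)
    convert h using 2
    push_cast
    ring
  have hlog2 := Real.log_pos one_lt_two
  have hl0 : 0 < l := hlog2.trans_le hl
  set ε := B / (K * L : ℝ) with hε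
  set R := 64 * N * L * B + 64 * L * Fintype.card S *
        Real.sqrt (Fintype.card A * N * (K * L : ℝ) * l')
  let b₁ : History S A D L K → ℝ := fun h => ind (8 * (N : ℝ) < agentFailures M δ h)
  let b₂ : History S A D L K → ℝ := fun h => ∑ k : Fin K, if ⌈B⌉₊ ≤ (k : ℕ) then
      ind (¬ EnvGood M δ ε (h.past k)) else 0
  let b₃ : History S A D L K → ℝ := fun h => ind
      (2 * ∑ k : Fin K, totalWidth δ (h.past k) (h k) + 8 * N * L * Real.log (4 / δ) <
        ∑ k : Fin K, epExp M (h.past k) (totalWidth δ (h.past k)))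
  have hb₁ : ∀ h, 0 ≤ b₁ h := fun h => ind_nonneg _
  have hb₂' : ∀ (h : History S A D L K) (k : Fin K), 0 ≤ (if ⌈B⌉₊ ≤ (k : ℕ) then
      ind (¬ EnvGood M δ ε (h.past k)) else 0) := fun h k => by
    split_ifs
    · exact ind_nonneg _
    · exact le_rfl
  have hb₂ : ∀ h, 0 ≤ b₂ h := fun h => Finset.sum_nonneg fun k _ => hb₂' h k
  have hb₃ : ∀ h, 0 ≤ b₃ h := fun h => ind_nonneg _
  -- Pointwise form of the union bound: either the regret bound holds or one of the three bad
  -- quantities is at least one. Each has expectation at most δ/4.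
  have hpt : ∀ h, 1 ≤ ind (regret C M.pD M.p M.init M.π h ≤ R) + (b₁ h + b₂ h + b₃ h) := by
    intro h
    have h0 := ind_nonneg (regret C M.pD M.p M.init M.π h ≤ R)
    by_cases c₁ : 8 * (N : ℝ) < agentFailures M δ h
    · have : b₁ h = 1 := ind_pos c₁
      linarith [hb₂ h, hb₃ h]
    by_cases c₃ : 2 * ∑ k : Fin K, totalWidth δ (h.past k) (h k) +
        8 * N * L * Real.log (4 / δ) <
        ∑ k : Fin K, epExp M (h.past k) (totalWidth δ (h.past k))
    · have : b₃ h = 1 := ind_pos c₃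
      linarith [hb₂ h, hb₁ h]
    by_cases c₂ : ∀ k : Fin K, ⌈B⌉₊ ≤ (k : ℕ) → EnvGood M δ ε (h.past k)
    · have hreg : regret C M.pD M.p M.init M.π h ≤ R := by
        refine (regret_le_of_envGood M C h hC (by positivity) hopt
          (Nat.one_le_ceil_iff.2 (by linarith)) c₂).trans ?_
        refine total_le hδ hδ1 hL hs ha hd hK hB0 hB hBK (Nat.ceil_lt_add_one hB0).le
          (not_lt.1 c₁) (not_lt.1 c₃) hε (by linarith) ?_
        refine sum_totalWidth_le h (by positivity) ?_ hD ?_ ?_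
        · have : 0 ≤ l' := by linarith
          positivity
        · intro k i s dd
          refine Real.sqrt_le_sqrt (div_le_div_of_nonneg_right ?_ (by positivity))
          have := log_radius_le (k := k) (K := K) (L := L) (s := Fintype.card S)
            (d := Fintype.card (D i)) (d' := d) hδ hδ1 k.is_lt.le (hD i) ha hl
          linarith
        · intro k s a
          refine Real.sqrt_le_sqrt (div_le_div_of_nonneg_right ?_ (by positivity))
          have := log_radius_le (k := k) (K := K) (L := L) (s := Fintype.card S)
            (d := Fintype.card A) (d' := Fintype.card A) hδ hδ1 k.is_lt.le le_rfl hs hl'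
          linarith
      rw [ind_pos hreg]
      linarith [hb₁ h, hb₂ h, hb₃ h]
    · push Not at c₂
      obtain ⟨k, hk, hbad⟩ := c₂
      have : 1 ≤ b₂ h := by
        refine le_trans (le_of_eq ?_) (Finset.single_le_sum (fun k _ => hb₂' h k)
          (Finset.mem_univ k))
        rw [if_pos hk, ind_pos hbad]
      linarith [hb₁ h, hb₃ h]
  have hsum := runExp_mono M hpt
  rw [runExp_const, runExp_add, runExp_add, runExp_add] at hsum
  have e₁ : runExp M b₁ ≤ δ / 4 := runExp_many_agentFailures_le M hδ hδ1 hL hN K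
  have e₂ : runExp M b₂ ≤ δ / 4 := runExp_env_failures_le M hδ hδ1 hL hd hK hB0 hB hBK
  have e₃ : runExp M b₃ ≤ δ / 4 := runExp_large_width_le M hδ hL hN K
  linarith

end Final

end Switching

open Switching Fintype in
theorem corollary1 :
    ∃ ρ₁ ρ₂ : ℝ, 0 < ρ₁ ∧ 0 < ρ₂ ∧
      ∀ (N K L : ℕ) (S A : Type*) (D : Fin N → Type*)
        [Fintype S] [Fintype A] [∀ i, Fintype (D i)]
        [DecidableEq S] [DecidableEq A] [∀ i, DecidableEq (D i)]
        (C : (i : Fin N) → Costs S A (D i))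
        (_ : ∀ i s a d d', 0 ≤ (C i).step s a d d' ∧ (C i).step s a d d' ≤ 1)
        (pD : (i : Fin N) → S → D i → A → ℝ) (_ : ∀ i s d, pD i s d ∈ stdSimplex ℝ A)
        (p : S → A → S → ℝ) (_ : ∀ s a, p s a ∈ stdSimplex ℝ S)
        (δ : ℝ) (_ : 0 < δ) (_ : δ < 1)
        (init : (k : ℕ) → History S A D L k → (i : Fin N) → S × D i)
        (π : (k : ℕ) → History S A D L k → (i : Fin N) → Policy S (D i) L)
        (_ : IsSharedUCRL2MC C δ init π),
        1 - δ ≤ probability pD p init π {h : History S A D L K |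
          regret C pD p init π h ≤
            ρ₁ * N * L * Real.sqrt (card A * card S * teamSize D * (K * L : ℝ) *
              Real.log (card S * teamSize D * (K * L : ℝ) / δ)) +
            ρ₂ * L * card S * Real.sqrt (card A * N * (K * L : ℝ) *
              Real.log (card S * card A * (K * L : ℝ) / δ))} := by
  refine ⟨64, 64, by norm_num, by norm_num, ?_⟩
  intro N K L S A D _ _ _ _ _ _ C hC pD hpD p hp δ hδ hδ1 init π hopt
  let M : Setting S A D L := ⟨pD, hpD, p, hp, init, π⟩
  set B := Real.sqrt (card A * card S * teamSize D * (K * L : ℝ) *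
              Real.log (card S * teamSize D * (K * L : ℝ) / δ)) with hBdef
  have hB0 : 0 ≤ B := Real.sqrt_nonneg _
  set E := Real.sqrt (card A * N * (K * L : ℝ) * Real.log (card S * card A * (K * L : ℝ) / δ))
  have hE0 : 0 ≤ 64 * L * card S * E := mul_nonneg (by positivity) (Real.sqrt_nonneg _)
  rcases Nat.lt_or_ge (teamSize D) 2 with hD | hD
  · rw [probability_eq_one M fun h => by
      rw [regret_eq_zero M C (Nat.lt_succ_iff.1 hD) h]; positivity]
    linarith
  -- If K ≤ 8B the trivial bound NKL is at most 8NLB. The comparison is multiplied by L so that L =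
  -- 0 also falls into this case.
  rcases le_or_gt ((K : ℝ) * L) (8 * B * L) with hKB | hKB
  · rw [probability_eq_one M fun h => by
      refine (regret_le_trivial M C h hC).trans ?_
      have h1 : (N : ℝ) * (K * L) ≤ N * (8 * B * L) := by gcongr
      have h2 : 0 ≤ N * (8 * B * L) := by positivity
      linarith]
    linarith
  have hL : 1 ≤ L := by
    by_contra hL
    have : L = 0 := by omega
    simp [this] at hKB
  have hL' : (0 : ℝ) < L := by exact_mod_cast hL
  have hBK : 8 * B < K := lt_of_mul_lt_mul_right hKB hL'.le
  have hN : 1 ≤ N := by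
    by_contra hN
    obtain rfl : N = 0 := by omega
    simp [teamSize] at hD
  have hK : 1 ≤ K := by
    have : (0 : ℝ) < K := by linarith
    exact_mod_cast this
  have hs : 1 ≤ card S := card_pos_iff.2 ⟨(init 0 Fin.elim0 ⟨0, hN⟩).1⟩
  have hl := (Real.log_pos one_lt_two).le.trans (log_two_le_log hδ hδ1 hL hs hD hK)
  rw [probability_eq_runExp M]
  exact one_sub_le_runExp M C hC hδ hδ1 hopt hN hL hD card_le_teamSize hB0
    (Real.sq_sqrt (by positivity)) hBK
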